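/- For $1\le p<\infty$ let $L^p_{2\pi}$ be the set of $2\pi$-periodic functions $f:\mathbb R\to\mathbb R$ with $\|f\|_p:=\bigl(\int_0^{2\pi}|f(x)|^p\,dx\bigr)^{1/p}<\infty$, and let $L^\infty_{2\pi}$ be the set of $2\pi$-periodic functions that are uniformly continuous and bounded on $\mathbb R$, with $\|f\|_\infty:=\sup_{x}|f(x)|$. Put $\Delta_hf(x)=f(x+h)-f(x)$. For a nondecreasing function $w:[0,\infty)\to[0,\infty)$ let $$\|f\|_{w,p}:=\|f\|_p+\sup_{h\ne0}\frac{\|\Delta_hf\|_p}{w(|h|)},$$ and let $H^{w,p}$ be the set of $f\in L^p_{2\pi}$ with $\sup_{h\neq 0}\|\Delta_hf\|_p/w(|h|)<\infty$ (quotients in $[0,\infty]$, $0/0=0$, $a/0=\infty$ for $a>0$; in products $0\cdot\infty=0$). For $w(t)=t^\alpha$ write $H^{\alpha,p}$ and $\|\cdot\|_{\alpha,p}$. Let $c_k(f)=\frac1{2\pi}\int_0^{2\pi}f(t)e^{-ikt}\,dt$, and for $\gamma>0$ and $n\ge1$ let $$R_n(\gamma,f;x)=\sum_{k=-n}^{n}\Bigl(1-\frac{|k|}{n}\Bigr)^{\gamma}c_k(f)e^{ikx}.$$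 Let $1\le p\le\infty$ and $\gamma>0$. (1) Let $0\le\beta<\eta\le1$ and let $\omega,\omega^*:[0,\infty)\to[0,\infty)$ be nondecreasing. For every $f\in H^{\omega,p}$ there is a constant $C$, independent of $n$, such that for all $n\ge1$ $$\|R_n(\gamma,f)-f\|_{\omega^*,p}\le C\,\sup_{h\ne0}\frac{\omega(|h|)^{\beta/\eta}}{\omega^*(|h|)}\;\cdot\;\frac1n\sum_{k=1}^n\omega\Bigl(\frac1k\Bigr)^{1-\beta/\eta}.$$ (2) Let $0\le\beta<\alpha\le1$. For every $f\in H^{\alpha,p}$ there is a constant $C$, independent of $n$, such that $$\|R_n(\gamma,f)-f\|_{\beta,p}\le C\,n^{\beta-\alpha}\quad(n\ge1)\qquad\text{if }\alpha-\beta<1,$$ $$\|R_n(\gamma,f)-f\|_{\beta,p}\le C\,\frac{\ln n}{n}\quad(n\ge2)\qquad\text{if }\alpha-\beta=1.$$ (3) $R_n(1,f)$ is the Fejér mean $\sigma_n(f)=\frac1n\sum_{m=0}^{n-1}S_m(f)$, where $S_m(f;x)=\sum_{|k|\le m}c_k(f)e^{ikx}$; hence (1) and (2) hold in particular for the Fejér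 means. -/

import Mathlib

open MeasureTheory Set
open scoped NNReal ENNReal

noncomputable section

/-- The `p`-norm of a `2π`-periodic function: the `L^p`-norm over one period if `p < ∞`,
and the supremum norm if `p = ∞`. -/
def perNorm {E : Type*} [NormedAddCommGroup E] (p : ℝ≥0∞) (g : ℝ → E) : ℝ≥0∞ :=
  if p = ∞ then ⨆ x : ℝ, ‖g x‖ₑ
  else eLpNorm g p (volume.restrict (Ioc 0 (2 * Real.pi)))

/-- The real-valued `2π`-periodic functions of class `L^p`: integrable to the `p`-th power over a
period if `p < ∞`, and uniformly continuous and bounded on `ℝ` if `p = ∞`. -/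
def PerLp (p : ℝ≥0∞) : Set (ℝ → ℝ) :=
  {f | Function.Periodic f (2 * Real.pi) ∧
    if p = ∞ then UniformContinuous f ∧ ∃ M : ℝ, ∀ x, |f x| ≤ M
    else MemLp f p (volume.restrict (Ioc 0 (2 * Real.pi)))}

/-- `sup_{h ≠ 0} ‖Δ_h g‖_p / w(|h|)`, where `Δ_h g (x) = g (x + h) - g x`; the quotients are taken
in `[0, ∞]`, so that `0 / 0 = 0` and `a / 0 = ∞` for `a ≠ 0`. -/
def holderSeminorm {E : Type*} [NormedAddCommGroup E] (w : ℝ≥0 → ℝ≥0) (p : ℝ≥0∞)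
    (g : ℝ → E) : ℝ≥0∞ :=
  ⨆ (h : ℝ) (_ : h ≠ 0), perNorm p (fwdDiff h g) / (w ‖h‖₊ : ℝ≥0∞)

/-- The generalized Hölder norm `‖g‖_{w,p} = ‖g‖_p + sup_{h ≠ 0} ‖Δ_h g‖_p / w(|h|)`. -/
def holderNorm {E : Type*} [NormedAddCommGroup E] (w : ℝ≥0 → ℝ≥0) (p : ℝ≥0∞)
    (g : ℝ → E) : ℝ≥0∞ :=
  perNorm p g + holderSeminorm w p g

/-- The `2π`-periodic functions in the generalized Hölder class `H^{w,p}`. -/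
def PerHolder (w : ℝ≥0 → ℝ≥0) (p : ℝ≥0∞) : Set (ℝ → ℝ) :=
  {f | f ∈ PerLp p ∧ holderSeminorm w p f < ∞}

/-- The Fourier coefficient `c_k(f) = (1/2π) ∫_0^{2π} f(t) e^{-ikt} dt`. -/
def coeff (f : ℝ → ℝ) (k : ℤ) : ℂ :=
  fourierCoeffOn Real.two_pi_pos (fun t => (f t : ℂ)) k

/-- The Riesz mean `R_n(γ, f; x) = ∑_{|k| ≤ n} (1 - |k|/n)^γ c_k(f) e^{ikx}`. -/
def rieszMean (γ : ℝ) (n : ℕ) (f : ℝ → ℝ) (x : ℝ) : ℂ :=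
  ∑ k ∈ Finset.Icc (-(n : ℤ)) (n : ℤ),
    (((1 - |(k : ℝ)| / (n : ℝ)) ^ γ : ℝ) : ℂ) * coeff f k * Complex.exp (Complex.I * k * x)

/-- The partial sum `S_m(f; x) = ∑_{|k| ≤ m} c_k(f) e^{ikx}` of the Fourier series. -/
def partialSum (m : ℕ) (f : ℝ → ℝ) (x : ℝ) : ℂ :=
  ∑ k ∈ Finset.Icc (-(m : ℤ)) (m : ℤ), coeff f k * Complex.exp (Complex.I * k * x)

/-- The Fejér mean `σ_n(f; x)`, the arithmetic mean of `S_0(f; x), …, S_{n-1}(f; x)`. -/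
def fejerMean (n : ℕ) (f : ℝ → ℝ) (x : ℝ) : ℂ :=
  (1 / (n : ℂ)) * ∑ m ∈ Finset.range n, partialSum m f x

end

/-!
The difference `R_n(γ, f) - f` is the average of the differences `f(x + t) - f(x)` against the
kernel `K_n(t) = ∑_{|k| ≤ n} (1 - |k|/n)^γ e^{ikt}`. Everything rests on the estimate `‖R_n(γ, G)
- G‖_p ≤ (C/n) ∑_{k = 1}^n ω_p(G, 1/k)` with `C` depending only on `γ`
(`perNorm_convDiff_rieszWeight_le`), where `ω_p(G, δ) = sup_{|t| ≤ δ} ‖Δ_t G‖_p`.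

For the Fejér kernels the estimate follows from the bound `min (n, π² / (n t²))` by cutting the
period at the points `1/k` and applying Minkowski's inequality on each piece
(`perNorm_convDiff_dirichletSum_le`). Two summations by parts write a kernel with even weights `a`
as `∑_j (a_j - 2 a_{j+1} + a_{j+2}) (j + 1) F_{j+1}` with Fejér kernels `F_j`, so the estimate
carries over to all weights whose second differences have an absolute sum of order `1/n`
(`perNorm_convDiff_evenKernel_le`). This covers `γ ≥ 1`, where the weights are convex.

For `γ < 1` the second differences are too large near `k = n`. The weights are there replaced
beyond `m = ⌊n/2⌋` by the chord to `n`, which leaves concave weights with decrements at most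
`2/n`. The remainder has weights vanishing for `k ≤ m`; its kernel has a bounded `L¹` norm
(`ConcaveWeights.lintegral_evenKernel_le`) and annihilates the Fejér mean `σ_{m+1} G`
(`perConv_perConv_eq_zero`), so it contributes at most a constant times `‖G - σ_{m+1} G‖_p`.

The Hölder norm is estimated by applying this to `G = f` and to `G = Δ_h f`, since the averages
commute with differences. In the second case `‖Δ_t Δ_h f‖_p` is at most a constant times `min
(ω(|h|), ω(|t|)) ≤ ω(|h|)^θ ω(|t|)^{1-θ}` with `θ = β/η` (`holderNorm_rieszMean_sub_le`).
-/

/-! ### The `p`-norm over a period -/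

/-- The `2π`-periodic complex functions integrable over bounded intervals. -/
structure PeriodicIntegrable (G : ℝ → ℂ) : Prop where
  periodic : Function.Periodic G (2 * Real.pi)
  meas : AEStronglyMeasurable G volume
  int : ∀ a b, IntervalIntegrable G volume a b

theorem PeriodicIntegrable.of_continuous {G : ℝ → ℂ} (h : Function.Periodic G (2 * Real.pi))
    (hc : Continuous G) : PeriodicIntegrable G :=
  ⟨h, hc.aestronglyMeasurable, fun a b => hc.intervalIntegrable a b⟩

theorem PeriodicIntegrable.translate {G : ℝ → ℂ} (hG : PeriodicIntegrable G) (h : ℝ) :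
    PeriodicIntegrable (fun x => G (x + h)) := by
  refine ⟨fun x => ?_, ?_, fun a b => ?_⟩
  · have := hG.periodic (x + h)
    rw [← this]; congr 1; ring
  · exact hG.meas.comp_quasiMeasurePreserving
      (measurePreserving_add_right volume h).quasiMeasurePreserving
  · simpa using (hG.int (a + h) (b + h)).comp_add_right h

theorem PeriodicIntegrable.sub {G H : ℝ → ℂ} (hG : PeriodicIntegrable G)
    (hH : PeriodicIntegrable H) : PeriodicIntegrable (fun x => G x - H x) :=
  ⟨fun x => by simp only [hG.periodic x, hH.periodic x], hG.meas.sub hH.meas,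
    fun a b => (hG.int a b).sub (hH.int a b)⟩

theorem PeriodicIntegrable.fwdDiff {G : ℝ → ℂ} (hG : PeriodicIntegrable G) (h : ℝ) :
    PeriodicIntegrable (fwdDiff h G) :=
  (hG.translate h).sub hG

theorem perNorm_congr_norm {E F : Type*} [NormedAddCommGroup E] [NormedAddCommGroup F]
    (p : ℝ≥0∞) {g : ℝ → E} {h : ℝ → F} (H : ∀ x, ‖g x‖ = ‖h x‖) : perNorm p g = perNorm p h := by
  have H' : ∀ x, ‖g x‖ₑ = ‖h x‖ₑ := fun x => by
    rw [← ofReal_norm, ← ofReal_norm, H]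
  unfold perNorm
  split_ifs
  · simp only [H']
  · exact eLpNorm_congr_norm_ae (Filter.Eventually.of_forall H)

theorem perNorm_zero (p : ℝ≥0∞) : perNorm p (fun _ => (0 : ℂ)) = 0 := by
  unfold perNorm
  split_ifs <;> simp

theorem perNorm_add_le {p : ℝ≥0∞} (hp : 1 ≤ p) {G H : ℝ → ℂ} (hG : AEStronglyMeasurable G volume)
    (hH : AEStronglyMeasurable H volume) :
    perNorm p (fun x => G x + H x) ≤ perNorm p G + perNorm p H := by
  unfold perNorm
  split_ifs
  · exact iSup_le fun x => (enorm_add_le _ _).trans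
      (add_le_add (le_iSup (fun x => ‖G x‖ₑ) x) (le_iSup (fun x => ‖H x‖ₑ) x))
  · exact eLpNorm_add_le hG.restrict hH.restrict hp

theorem perNorm_neg (p : ℝ≥0∞) (G : ℝ → ℂ) : perNorm p (fun x => - G x) = perNorm p G :=
  perNorm_congr_norm p fun _ => norm_neg _

theorem perNorm_sub_le {p : ℝ≥0∞} (hp : 1 ≤ p) {G H : ℝ → ℂ} (hG : AEStronglyMeasurable G volume)
    (hH : AEStronglyMeasurable H volume) :
    perNorm p (fun x => G x - H x) ≤ perNorm p G + perNorm p H := by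
  rw [← perNorm_neg p H]
  simp only [sub_eq_add_neg]
  exact perNorm_add_le hp hG hH.neg

theorem perNorm_const_mul (p : ℝ≥0∞) (c : ℂ) (G : ℝ → ℂ) :
    perNorm p (fun x => c * G x) = ‖c‖ₑ * perNorm p G := by
  unfold perNorm
  split_ifs
  · simp only [enorm_mul, ENNReal.mul_iSup]
  · exact eLpNorm_const_smul c G p _

theorem perNorm_sum_le {p : ℝ≥0∞} (hp : 1 ≤ p) {ι : Type*} (s : Finset ι) {G : ι → ℝ → ℂ}
    (hG : ∀ i ∈ s, AEStronglyMeasurable (G i) volume) :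
    perNorm p (fun x => ∑ i ∈ s, G i x) ≤ ∑ i ∈ s, perNorm p (G i) := by
  classical
  induction s using Finset.induction_on with
  | empty => simp [perNorm_zero]
  | insert a s ha ih =>
    simp only [Finset.sum_insert ha]
    refine (perNorm_add_le hp (hG a (by simp)) ?_).trans
      (add_le_add le_rfl (ih fun i hi => hG i (by simp [hi])))
    have := Finset.aestronglyMeasurable_sum s (f := G) (μ := volume)
      fun i hi => hG i (by simp [hi])
    exact this.congr (Filter.Eventually.of_forall fun x => by simp)

theorem perNorm_translate (p : ℝ≥0∞) {G : ℝ → ℂ} (hG : PeriodicIntegrable G) (h : ℝ) :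
    perNorm p (fun x => G (x + h)) = perNorm p G := by
  unfold perNorm
  split_ifs with hp
  · exact (Equiv.addRight h).iSup_congr fun _ => rfl
  · rcases eq_or_ne p 0 with rfl | h0
    · simp
    rw [eLpNorm_eq_lintegral_rpow_enorm_toReal h0 hp, eLpNorm_eq_lintegral_rpow_enorm_toReal h0 hp]
    congr 1
    have h1 := (measurePreserving_add_right volume h).setLIntegral_comp_preimage_emb
      (measurableEmbedding_addRight h) (fun x => ‖G x‖ₑ ^ p.toReal) (Ioc h (h + 2 * Real.pi))
    have h2 : (fun x : ℝ => x + h) ⁻¹' (Ioc h (h + 2 * Real.pi)) = Ioc 0 (2 * Real.pi) := by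
      ext x; simp only [mem_preimage, mem_Ioc]
      constructor <;> rintro ⟨h1, h2⟩ <;> constructor <;> linarith
    rw [h2] at h1
    rw [h1]
    have h3 := (isAddFundamentalDomain_Ioc Real.two_pi_pos h volume).setLIntegral_eq
      (isAddFundamentalDomain_Ioc Real.two_pi_pos 0 volume) (fun x => ‖G x‖ₑ ^ p.toReal) ?_
    · rw [h3, zero_add]
    · rintro ⟨g, hg⟩ x
      obtain ⟨n, rfl⟩ := AddSubgroup.mem_zmultiples_iff.1 hg
      have : ((⟨n • (2 * Real.pi), hg⟩ : AddSubgroup.zmultiples (2 * Real.pi)) +ᵥ x)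
          = x + n • (2 * Real.pi) := by
        rw [add_comm]; rfl
      simp only [this, hG.periodic.zsmul n x]

/-- Hölder's inequality, or Jensen's inequality for the weight `κ`. -/
theorem rpow_lintegral_mul_le {κ g : ℝ → ℝ≥0∞} {μ : Measure ℝ} (hκ : AEMeasurable κ μ)
    (hg : AEMeasurable g μ) {r : ℝ} (hr : 1 ≤ r) :
    (∫⁻ t, κ t * g t ∂μ) ^ r ≤ (∫⁻ t, κ t ∂μ) ^ (r - 1) * ∫⁻ t, κ t * g t ^ r ∂μ := by
  have hr0 : 0 < r := by linarith
  have hg' : AEMeasurable g (μ.withDensity κ) := hg.mono_ac (withDensity_absolutelyContinuous _ _)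
  have h := eLpNorm_le_eLpNorm_mul_rpow_measure_univ (p := 1) (q := ENNReal.ofReal r)
    (by simpa using hr) hg'.aestronglyMeasurable
  rw [eLpNorm_one_eq_lintegral_enorm, eLpNorm_eq_lintegral_rpow_enorm_toReal (by simpa using hr0)
    (by simp), ENNReal.toReal_ofReal hr0.le] at h
  simp only [enorm_eq_self, withDensity_apply _ MeasurableSet.univ, Measure.restrict_univ,
    ENNReal.toReal_one, div_one] at h
  rw [lintegral_withDensity_eq_lintegral_mul₀ hκ hg,
    lintegral_withDensity_eq_lintegral_mul₀ hκ (hg.pow_const r)] at h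
  simp only [Pi.mul_apply] at h
  have h2 := ENNReal.rpow_le_rpow h hr0.le
  rw [ENNReal.mul_rpow_of_nonneg _ _ hr0.le, ← ENNReal.rpow_mul, ← ENNReal.rpow_mul] at h2
  have e1 : (1 - 1 / r) * r = r - 1 := by field_simp
  rw [e1, one_div_mul_cancel hr0.ne', ENNReal.rpow_one, mul_comm] at h2
  exact h2

/-- Minkowski's integral inequality for an average of functions with uniformly bounded norm. -/
theorem perNorm_setIntegral_mul_le {p : ℝ≥0∞} (hp : 1 ≤ p) {K : ℝ → ℂ} (hK : Continuous K)
    {H : ℝ → ℝ → ℂ} (hH : AEStronglyMeasurable (Function.uncurry H) (volume.prod volume))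
    {A : Set ℝ} (hA : MeasurableSet A) {M : ℝ≥0∞} (hM : ∀ t ∈ A, perNorm p (fun x => H x t) ≤ M) :
    perNorm p (fun x => ∫ t in A, K t * H x t) ≤ (∫⁻ t in A, ‖K t‖ₑ) * M := by
  have hKm : Measurable fun t => ‖K t‖ₑ := hK.measurable.enorm
  have h0 : ∀ x, ‖∫ t in A, K t * H x t‖ₑ ≤ ∫⁻ t in A, ‖K t‖ₑ * ‖H x t‖ₑ := fun x =>
    (enorm_integral_le_lintegral_enorm _).trans (by simp only [enorm_mul]; rfl)
  unfold perNorm at *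
  split_ifs at * with hpt
  · refine iSup_le fun x => (h0 x).trans ?_
    rw [← lintegral_mul_const _ hKm]
    refine setLIntegral_mono' hA fun t ht => ?_
    gcongr
    exact (le_iSup (fun x => ‖H x t‖ₑ) x).trans (hM t ht)
  · have hp0 : p ≠ 0 := (zero_lt_one.trans_le hp).ne'
    have hr : 1 ≤ p.toReal := by
      simpa using (ENNReal.toReal_le_toReal (by simp) hpt).2 hp
    have hr0 : 0 < p.toReal := by linarith
    simp only [eLpNorm_eq_lintegral_rpow_enorm_toReal hp0 hpt] at *
    rw [one_div, ENNReal.rpow_inv_le_iff hr0]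
    set r := p.toReal
    set P := volume.restrict (Ioc 0 (2 * Real.pi))
    have hM' : ∀ t ∈ A, ∫⁻ x, ‖H x t‖ₑ ^ r ∂P ≤ M ^ r := fun t ht => by
      have := hM t ht
      rwa [one_div, ENNReal.rpow_inv_le_iff hr0] at this
    have hH' : AEStronglyMeasurable (Function.uncurry H) (P.prod (volume.restrict A)) := by
      rw [Measure.prod_restrict]; exact hH.restrict
    calc ∫⁻ x, ‖∫ t in A, K t * H x t‖ₑ ^ r ∂P
        ≤ ∫⁻ x, (∫⁻ t in A, ‖K t‖ₑ) ^ (r - 1) * (∫⁻ t in A, ‖K t‖ₑ * ‖H x t‖ₑ ^ r) ∂P := by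
          refine lintegral_mono_ae ?_
          filter_upwards [hH'.prodMk_left] with x hx
          exact (ENNReal.rpow_le_rpow (h0 x) hr0.le).trans
            (rpow_lintegral_mul_le hKm.aemeasurable hx.enorm hr)
      _ = (∫⁻ t in A, ‖K t‖ₑ) ^ (r - 1) * ∫⁻ t in A, (∫⁻ x, ‖K t‖ₑ * ‖H x t‖ₑ ^ r ∂P) := by
          have hm : AEMeasurable (Function.uncurry fun x t => ‖K t‖ₑ * ‖H x t‖ₑ ^ r)
              (P.prod (volume.restrict A)) :=
            (hKm.comp measurable_snd).aemeasurable.mul (hH'.enorm.pow_const r)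
          have hm' := hm.lintegral_prod_right'
          simp only [Function.uncurry_apply_pair] at hm'
          rw [lintegral_const_mul'' _ hm', lintegral_lintegral_swap hm]
      _ ≤ (∫⁻ t in A, ‖K t‖ₑ) ^ (r - 1) * ∫⁻ t in A, ‖K t‖ₑ * M ^ r := by
          gcongr 1
          have hs : ∀ᵐ t ∂(volume.restrict A), AEStronglyMeasurable (fun x => H x t) P :=
            hH'.prod_swap.prodMk_left
          refine lintegral_mono_ae ?_
          filter_upwards [hs, ae_restrict_mem hA] with t ht htA
          rw [lintegral_const_mul'' _ (ht.enorm.pow_const r)]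
          gcongr
          exact hM' t htA
      _ = ((∫⁻ t in A, ‖K t‖ₑ) * M) ^ r := by
          rw [lintegral_mul_const _ hKm, ENNReal.mul_rpow_of_nonneg _ _ hr0.le, ← mul_assoc]
          congr 1
          conv_rhs => rw [show r = (r - 1) + 1 by ring,
            ENNReal.rpow_add_of_nonneg _ _ (by linarith) zero_le_one, ENNReal.rpow_one]

theorem perNorm_fwdDiff_natMul_le {p : ℝ≥0∞} (hp : 1 ≤ p) {G : ℝ → ℂ} (hG : PeriodicIntegrable G)
    (s : ℝ) (N : ℕ) : perNorm p (fwdDiff (N * s) G) ≤ N * perNorm p (fwdDiff s G) := by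
  induction N with
  | zero =>
    have e : fwdDiff ((0 : ℕ) * s) G = fun _ => 0 := by funext x; simp [fwdDiff]
    rw [e, perNorm_zero]; simp
  | succ N ih =>
    have e : fwdDiff ((N + 1 : ℕ) * s) G
        = fun x => fwdDiff s G (x + N * s) + fwdDiff (N * s) G x := by
      funext x
      simp only [fwdDiff]
      rw [show x + N * s + s = x + (N + 1 : ℕ) * s by push_cast; ring]
      ring
    rw [e]
    refine (perNorm_add_le hp ((hG.fwdDiff s).translate _).meas (hG.fwdDiff _).meas).trans ?_
    rw [perNorm_translate p (hG.fwdDiff s)]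
    push_cast
    rw [add_mul, one_mul, add_comm]
    gcongr

/-! ### Even trigonometric kernels and summation by parts -/

/-- The even trigonometric kernel `a 0 + 2 ∑_{k = 1}^n a k cos (k t)`. -/
noncomputable def evenKernel (a : ℕ → ℝ) (n : ℕ) (t : ℝ) : ℝ :=
  a 0 + 2 * ∑ k ∈ Finset.range n, a (k + 1) * Real.cos ((k + 1) * t)

/-- The Dirichlet kernel `D_m`. -/
noncomputable def dirichletKer (m : ℕ) (t : ℝ) : ℝ := evenKernel (fun _ => 1) m t

/-- The sum `D_0 + ⋯ + D_{j-1}` of Dirichlet kernels, that is, `j` times the Fejér kernel. -/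
noncomputable def dirichletSum (j : ℕ) (t : ℝ) : ℝ := ∑ m ∈ Finset.range j, dirichletKer m t

theorem evenKernel_succ (a : ℕ → ℝ) (n : ℕ) (t : ℝ) :
    evenKernel a (n + 1) t = evenKernel a n t + 2 * (a (n + 1) * Real.cos ((n + 1) * t)) := by
  simp only [evenKernel, Finset.sum_range_succ]; ring

theorem continuous_evenKernel (a : ℕ → ℝ) (n : ℕ) : Continuous (evenKernel a n) := by
  unfold evenKernel; fun_prop

theorem continuous_dirichletSum (j : ℕ) : Continuous (dirichletSum j) :=
  continuous_finsetSum _ fun m _ => continuous_evenKernel (fun _ => 1) m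

theorem evenKernel_neg (a : ℕ → ℝ) (n : ℕ) (t : ℝ) : evenKernel a n (-t) = evenKernel a n t := by
  simp [evenKernel]

theorem evenKernel_sub (a b : ℕ → ℝ) (n : ℕ) (t : ℝ) :
    evenKernel (fun k => a k - b k) n t = evenKernel a n t - evenKernel b n t := by
  simp only [evenKernel, sub_mul, Finset.sum_sub_distrib]; ring

theorem dirichletKer_succ (m : ℕ) (t : ℝ) :
    dirichletKer (m + 1) t = dirichletKer m t + 2 * Real.cos ((m + 1) * t) := by
  simp [dirichletKer, evenKernel_succ]

theorem dirichletSum_succ (j : ℕ) (t : ℝ) :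
    dirichletSum (j + 1) t = dirichletSum j t + dirichletKer j t := by
  simp [dirichletSum, Finset.sum_range_succ]

theorem sin_half_mul_dirichletKer (m : ℕ) (t : ℝ) :
    Real.sin (t / 2) * dirichletKer m t = Real.sin (m * t + t / 2) := by
  induction m with
  | zero => simp [dirichletKer, evenKernel]
  | succ m ih =>
    rw [dirichletKer_succ, mul_add, ih]
    push_cast
    have e : (m * t + t / 2 : ℝ) = (m + 1) * t - t / 2 := by ring
    rw [e, Real.sin_sub, Real.sin_add]
    ring

theorem sin_half_sq_mul_dirichletSum (j : ℕ) (t : ℝ) :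
    2 * Real.sin (t / 2) ^ 2 * dirichletSum j t = 1 - Real.cos (j * t) := by
  induction j with
  | zero => simp [dirichletSum]
  | succ j ih =>
    have h := sin_half_mul_dirichletKer j t
    rw [dirichletSum_succ, mul_add, ih]
    have e : 2 * Real.sin (t / 2) ^ 2 * dirichletKer j t
      = 2 * Real.sin (t / 2) * Real.sin (j * t + t / 2) := by rw [← h]; ring
    rw [e]
    have e1 : Real.cos (j * t) = Real.cos ((j * t + t / 2) - t / 2) := by ring_nf
    have e2 : Real.cos ((j + 1 : ℕ) * t) = Real.cos ((j * t + t / 2) + t / 2) := by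
      push_cast; ring_nf
    rw [e1, e2]
    generalize (j * t + t / 2 : ℝ) = u
    rw [Real.cos_sub, Real.cos_add]; ring

theorem abs_dirichletKer_le (m : ℕ) (t : ℝ) : |dirichletKer m t| ≤ 2 * m + 1 := by
  induction m with
  | zero => simp [dirichletKer, evenKernel]
  | succ m ih =>
    rw [dirichletKer_succ]
    have h1 := Real.abs_cos_le_one ((m + 1) * t)
    have h2 := abs_add_le (dirichletKer m t) (2 * Real.cos ((m + 1) * t))
    rw [abs_mul, abs_two] at h2
    push_cast; linarith

theorem abs_dirichletSum_le (j : ℕ) (t : ℝ) : |dirichletSum j t| ≤ (j : ℝ) ^ 2 := by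
  induction j with
  | zero => simp [dirichletSum]
  | succ j ih =>
    rw [dirichletSum_succ]
    have h1 := abs_dirichletKer_le j t
    have h2 := abs_add_le (dirichletSum j t) (dirichletKer j t)
    push_cast; nlinarith

theorem abs_div_pi_le_abs_sin_half {t : ℝ} (ht : |t| ≤ Real.pi) :
    |t| / Real.pi ≤ |Real.sin (t / 2)| := by
  have h := Real.mul_abs_le_abs_sin (x := t / 2) (by
    rw [abs_div, abs_two]; linarith)
  rw [abs_div, abs_two] at h
  calc |t| / Real.pi = 2 / Real.pi * (|t| / 2) := by ring
    _ ≤ _ := h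

theorem abs_dirichletKer_le_div (m : ℕ) {t : ℝ} (h0 : t ≠ 0) (ht : |t| ≤ Real.pi) :
    |dirichletKer m t| ≤ Real.pi / |t| := by
  have h1 := abs_div_pi_le_abs_sin_half ht
  have hpos := abs_pos.2 h0
  have h2 : |Real.sin (t / 2)| * |dirichletKer m t| ≤ 1 := by
    rw [← abs_mul, sin_half_mul_dirichletKer]; exact Real.abs_sin_le_one _
  have h3 : |t| / Real.pi * |dirichletKer m t| ≤ 1 :=
    (mul_le_mul_of_nonneg_right h1 (abs_nonneg _)).trans h2
  rw [le_div_iff₀ hpos]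
  rw [div_mul_eq_mul_div, div_le_one Real.pi_pos] at h3
  linarith

theorem dirichletSum_nonneg_and_le (j : ℕ) {t : ℝ} (h0 : t ≠ 0) (ht : |t| ≤ Real.pi) :
    0 ≤ dirichletSum j t ∧ dirichletSum j t ≤ Real.pi ^ 2 / t ^ 2 := by
  have h1 := abs_div_pi_le_abs_sin_half ht
  have hpos := abs_pos.2 h0
  have hs : t ^ 2 / Real.pi ^ 2 ≤ Real.sin (t / 2) ^ 2 := by
    rw [← sq_abs t, ← div_pow, ← sq_abs (Real.sin _)]
    exact pow_le_pow_left₀ (by positivity) h1 2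
  have ht2 : 0 < t ^ 2 / Real.pi ^ 2 := by positivity
  have hid := sin_half_sq_mul_dirichletSum j t
  have hc1 := Real.cos_le_one (j * t)
  have hc2 := Real.neg_one_le_cos (j * t)
  have hn : 0 ≤ dirichletSum j t := by
    by_contra! hneg
    nlinarith
  refine ⟨hn, ?_⟩
  have : t ^ 2 / Real.pi ^ 2 * dirichletSum j t ≤ 1 := by nlinarith
  rw [le_div_iff₀ (by positivity)]
  rw [div_mul_eq_mul_div, div_le_one (by positivity)] at this
  linarith

theorem evenKernel_eq_sum_dirichletKer (a : ℕ → ℝ) (n : ℕ) (t : ℝ) :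
    evenKernel a n t = ∑ j ∈ Finset.range n, (a j - a (j + 1)) * dirichletKer j t
      + a n * dirichletKer n t := by
  induction n with
  | zero => simp [evenKernel, dirichletKer]
  | succ n ih =>
    rw [evenKernel_succ, ih, Finset.sum_range_succ, dirichletKer_succ]; ring

theorem sum_mul_dirichletKer (d : ℕ → ℝ) (n : ℕ) (t : ℝ) :
    ∑ j ∈ Finset.range n, d j * dirichletKer j t
      = ∑ j ∈ Finset.range n, (d j - d (j + 1)) * dirichletSum (j + 1) t
        + d n * dirichletSum n t := by
  induction n with
  | zero => simp [dirichletSum]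
  | succ n ih =>
    rw [Finset.sum_range_succ, ih, Finset.sum_range_succ, dirichletSum_succ]; ring

/-- The second difference `a j - 2 a (j + 1) + a (j + 2)`. -/
def secondDiff (a : ℕ → ℝ) (j : ℕ) : ℝ := (a j - a (j + 1)) - (a (j + 1) - a (j + 2))

/-- Two summations by parts express a kernel through Fejér kernels. -/
theorem evenKernel_eq_sum_dirichletSum {a : ℕ → ℝ} {n : ℕ} (h0 : a n = 0) (h1 : a (n + 1) = 0)
    (t : ℝ) :
    evenKernel a n t = ∑ j ∈ Finset.range n, secondDiff a j * dirichletSum (j + 1) t := by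
  rw [evenKernel_eq_sum_dirichletKer, sum_mul_dirichletKer (fun j => a j - a (j + 1))]
  simp [h0, h1, secondDiff]

/-! ### Concave multipliers -/

/-- The sequence `a` decreases from `a 0 ≤ 1` to `0` on `{0, …, n}` in a concave way, and vanishes
from `n` on. -/
structure ConcaveWeights (a : ℕ → ℝ) (n : ℕ) : Prop where
  zero_le_one : a 0 ≤ 1
  vanish : ∀ k, n ≤ k → a k = 0
  anti : ∀ k, a (k + 1) ≤ a k
  concave : ∀ k, k + 1 < n → a k - a (k + 1) ≤ a (k + 1) - a (k + 2)

namespace ConcaveWeights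

variable {a : ℕ → ℝ} {n : ℕ}

theorem antitone (h : ConcaveWeights a n) : Antitone a := antitone_nat_of_succ_le h.anti

theorem nonneg (h : ConcaveWeights a n) (k : ℕ) : 0 ≤ a k := by
  rcases le_total n k with hk | hk
  · exact (h.vanish k hk).ge
  · rw [← h.vanish n le_rfl]; exact h.antitone hk

theorem decr_mono (h : ConcaveWeights a n) {i j : ℕ} (hij : i ≤ j) (hj : j < n) :
    a i - a (i + 1) ≤ a j - a (j + 1) := by
  induction j, hij using Nat.le_induction with
  | base => exact le_rfl
  | succ j hij ih => exact (ih (by omega)).trans (h.concave j hj)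

/-- The decrement at `m` is at most the mean slope on `{m + 1, …, n}`. -/
theorem mul_decr_le (h : ConcaveWeights a n) {m l : ℕ} (hl : m + 1 + l ≤ n) :
    (l : ℝ) * (a m - a (m + 1)) ≤ a (m + 1) - a (m + 1 + l) := by
  induction l with
  | zero => simp
  | succ l ih =>
    have h1 := ih (by omega)
    have h2 := h.decr_mono (i := m) (j := m + 1 + l) (by omega) (by omega)
    push_cast
    rw [show m + 1 + (l + 1) = m + 1 + l + 1 by ring]
    linarith

theorem sum_abs_secondDiff_le (h : ConcaveWeights a n) (hn : 1 ≤ n) :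
    ∑ j ∈ Finset.range n, |secondDiff a j| ≤ 2 * a (n - 1) := by
  obtain ⟨N, rfl⟩ : ∃ N, n = N + 1 := ⟨n - 1, by omega⟩
  have h1 : ∑ j ∈ Finset.range N, |secondDiff a j|
      = ∑ j ∈ Finset.range N, ((a (j + 1) - a (j + 1 + 1)) - (a j - a (j + 1))) :=
    Finset.sum_congr rfl fun j hj => by
      have := h.concave j (by have := Finset.mem_range.1 hj; omega)
      rw [secondDiff, abs_of_nonpos (by linarith)]; ring
  rw [Finset.sum_range_succ, h1, Finset.sum_range_sub (fun j => a j - a (j + 1)), secondDiff,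
    h.vanish (N + 1) le_rfl, h.vanish (N + 2) (by omega)]
  have h2 := h.nonneg N
  have h3 := h.anti 0
  rw [abs_of_nonneg (by linarith)]
  simp only [Nat.add_sub_cancel]
  linarith

theorem abs_evenKernel_le (h : ConcaveWeights a n) (t : ℝ) : |evenKernel a n t| ≤ 2 * n := by
  rcases Nat.eq_zero_or_pos n with rfl | hn
  · simp [evenKernel, h.vanish 0 le_rfl]
  rw [evenKernel_eq_sum_dirichletKer, h.vanish n le_rfl, zero_mul, add_zero]
  calc |∑ j ∈ Finset.range n, (a j - a (j + 1)) * dirichletKer j t|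
      ≤ ∑ j ∈ Finset.range n, |(a j - a (j + 1)) * dirichletKer j t| :=
        Finset.abs_sum_le_sum_abs _ _
    _ ≤ ∑ j ∈ Finset.range n, (a j - a (j + 1)) * (2 * n) := by
        refine Finset.sum_le_sum fun j hj => ?_
        have hj : (j : ℝ) + 1 ≤ n := by exact_mod_cast Finset.mem_range.1 hj
        have h1 := h.anti j
        rw [abs_mul, abs_of_nonneg (by linarith)]
        exact mul_le_mul_of_nonneg_left ((abs_dirichletKer_le j t).trans (by linarith))
          (by linarith)
    _ = (a 0 - a n) * (2 * n) := by rw [← Finset.sum_mul, Finset.sum_range_sub']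
    _ ≤ 2 * n := by
        rw [h.vanish n le_rfl]
        have := h.zero_le_one
        have : (0 : ℝ) ≤ n := Nat.cast_nonneg n
        nlinarith

/-- The kernel is controlled at `t` by the weight at distance about `1 / |t|` from the endpoint
`n`: the terms beyond are bounded individually, those before by summation by parts. -/
theorem abs_evenKernel_le_div (h : ConcaveWeights a n) {l : ℕ} (hl : l ≤ n) {t : ℝ} (h0 : t ≠ 0)
    (ht : |t| ≤ Real.pi) (hlt : 1 ≤ l * |t|) :
    |evenKernel a n t| ≤ a (n - l) * ((Real.pi + Real.pi ^ 2) / |t|) := by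
  obtain ⟨m, rfl⟩ : ∃ m, n = m + l := ⟨n - l, by omega⟩
  have hpos := abs_pos.2 h0
  rw [Nat.add_sub_cancel, evenKernel_eq_sum_dirichletKer, h.vanish _ le_rfl, zero_mul, add_zero,
    Finset.sum_range_add]
  have hfar : |∑ x ∈ Finset.range l, (a (m + x) - a (m + x + 1)) * dirichletKer (m + x) t|
      ≤ a m * (Real.pi / |t|) := by
    calc _ ≤ ∑ x ∈ Finset.range l, |(a (m + x) - a (m + x + 1)) * dirichletKer (m + x) t| :=
          Finset.abs_sum_le_sum_abs _ _
      _ ≤ ∑ x ∈ Finset.range l, (a (m + x) - a (m + (x + 1))) * (Real.pi / |t|) := by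
          refine Finset.sum_le_sum fun x _ => ?_
          have h1 := h.anti (m + x)
          rw [abs_mul, abs_of_nonneg (by linarith)]
          exact mul_le_mul_of_nonneg_left (abs_dirichletKer_le_div _ h0 ht) (sub_nonneg.2 h1)
      _ = a m * (Real.pi / |t|) := by
          rw [← Finset.sum_mul, Finset.sum_range_sub' (fun x => a (m + x)), add_zero,
            h.vanish _ le_rfl, sub_zero]
  have hnear : |∑ x ∈ Finset.range m, (a x - a (x + 1)) * dirichletKer x t|
      ≤ a m * (Real.pi ^ 2 / |t|) := by
    rcases m with _ | m
    · simp only [Finset.range_zero, Finset.sum_empty, abs_zero]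
      have := h.nonneg 0
      positivity
    set B := Real.pi ^ 2 / t ^ 2 with hB
    set d : ℕ → ℝ := fun j => a j - a (j + 1) with hd
    have hG := fun j => dirichletSum_nonneg_and_le j h0 ht
    have hdm : 0 ≤ d m := sub_nonneg.2 (h.anti m)
    have hlow : d m * |t| ≤ a (m + 1) * t ^ 2 := by
      have h1 := h.mul_decr_le (m := m) (l := l) le_rfl
      rw [h.vanish _ le_rfl, sub_zero] at h1
      have : d m ≤ a (m + 1) * |t| := by
        calc d m = d m * 1 := by ring
          _ ≤ d m * (l * |t|) := mul_le_mul_of_nonneg_left hlt hdm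
          _ = (l * d m) * |t| := by ring
          _ ≤ _ := mul_le_mul_of_nonneg_right h1 hpos.le
      calc d m * |t| ≤ (a (m + 1) * |t|) * |t| := mul_le_mul_of_nonneg_right this hpos.le
        _ = _ := by rw [← sq_abs t]; ring
    have hbound : d m * B ≤ a (m + 1) * (Real.pi ^ 2 / |t|) := by
      rw [hB, mul_div_assoc', mul_div_assoc', div_le_div_iff₀ (by positivity) hpos]
      have := mul_le_mul_of_nonneg_left hlow (sq_nonneg Real.pi)
      linarith
    refine le_trans ?_ hbound
    have hsum : ∑ x ∈ Finset.range (m + 1), d x * dirichletKer x t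
        = d m * dirichletSum (m + 1) t
          - ∑ j ∈ Finset.range m, (d (j + 1) - d j) * dirichletSum (j + 1) t := by
      rw [Finset.sum_range_succ, sum_mul_dirichletKer, dirichletSum_succ]
      have : ∑ j ∈ Finset.range m, (d (j + 1) - d j) * dirichletSum (j + 1) t
          = - ∑ j ∈ Finset.range m, (d j - d (j + 1)) * dirichletSum (j + 1) t := by
        rw [← Finset.sum_neg_distrib]
        exact Finset.sum_congr rfl fun j _ => by ring
      rw [this]; ring
    have hinc : ∀ j ∈ Finset.range m, 0 ≤ d (j + 1) - d j := fun j hj =>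
      sub_nonneg.2 (h.decr_mono (Nat.le_succ j) (by have := Finset.mem_range.1 hj; omega))
    have hs0 : 0 ≤ ∑ j ∈ Finset.range m, (d (j + 1) - d j) * dirichletSum (j + 1) t :=
      Finset.sum_nonneg fun j hj => mul_nonneg (hinc j hj) (hG _).1
    have hs1 : ∑ j ∈ Finset.range m, (d (j + 1) - d j) * dirichletSum (j + 1) t ≤ d m * B := by
      calc _ ≤ ∑ j ∈ Finset.range m, (d (j + 1) - d j) * B :=
            Finset.sum_le_sum fun j hj => mul_le_mul_of_nonneg_left (hG _).2 (hinc j hj)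
        _ = (d m - d 0) * B := by rw [← Finset.sum_mul, Finset.sum_range_sub]
        _ ≤ d m * B := by
            refine mul_le_mul_of_nonneg_right ?_ (by positivity)
            have : 0 ≤ d 0 := sub_nonneg.2 (h.anti 0)
            linarith
    have hm0 : 0 ≤ d m * dirichletSum (m + 1) t := mul_nonneg hdm (hG _).1
    have hm1 : d m * dirichletSum (m + 1) t ≤ d m * B := mul_le_mul_of_nonneg_left (hG _).2 hdm
    rw [hsum, abs_le]
    constructor <;> linarith
  calc _ ≤ a m * (Real.pi ^ 2 / |t|) + a m * (Real.pi / |t|) :=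
        (abs_add_le _ _).trans (add_le_add hnear hfar)
    _ = _ := by ring

end ConcaveWeights

/-! ### Convolution with a kernel -/

/-- The convolution `(1/2π) ∫_{-π}^{π} K(t) G(x + t) dt` over one period. -/
noncomputable def perConv (K : ℝ → ℂ) (G : ℝ → ℂ) (x : ℝ) : ℂ :=
  (1 / (2 * Real.pi) : ℂ) * ∫ t in Ioc (-Real.pi) Real.pi, K t * G (x + t)

/-- The average `(1/2π) ∫_{-π}^{π} K(t) (G(x + t) - G(x)) dt` of the differences of `G`. -/
noncomputable def convDiff (K : ℝ → ℝ) (G : ℝ → ℂ) (x : ℝ) : ℂ :=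
  (1 / (2 * Real.pi) : ℂ) * ∫ t in Ioc (-Real.pi) Real.pi, (K t : ℂ) * (G (x + t) - G x)

theorem PeriodicIntegrable.integrableOn_mul {G : ℝ → ℂ} (hG : PeriodicIntegrable G) {K : ℝ → ℂ}
    (hK : Continuous K) (x a b : ℝ) : IntegrableOn (fun t => K t * G (x + t)) (Ioc a b) := by
  rcases le_total a b with hab | hab
  · have h := (hG.translate x).int a b
    rw [intervalIntegrable_iff_integrableOn_Icc_of_le hab] at h
    have h2 := IntegrableOn.continuousOn_mul hK.continuousOn h isCompact_Icc
    refine (h2.mono_set Ioc_subset_Icc_self).congr_fun (fun t _ => ?_) measurableSet_Ioc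
    simp only [add_comm]
  · simp [Ioc_eq_empty_of_le hab]

theorem PeriodicIntegrable.integrableOn_diff {G : ℝ → ℂ} (hG : PeriodicIntegrable G) {K : ℝ → ℂ}
    (hK : Continuous K) (x a b : ℝ) :
    IntegrableOn (fun t => K t * (G (x + t) - G x)) (Ioc a b) := by
  simp only [mul_sub]
  refine (hG.integrableOn_mul hK x a b).sub ?_
  exact ((hK.mul continuous_const).integrableOn_Icc).mono_set Ioc_subset_Icc_self

theorem PeriodicIntegrable.meas_diff {G : ℝ → ℂ} (hG : PeriodicIntegrable G) :
    AEStronglyMeasurable (Function.uncurry fun x t : ℝ => G (x + t) - G x)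
      (volume.prod volume) :=
  (hG.meas.comp_quasiMeasurePreserving (quasiMeasurePreserving_add volume volume)).sub
    (hG.meas.comp_quasiMeasurePreserving Measure.quasiMeasurePreserving_fst)

theorem PeriodicIntegrable.meas_setIntegral {G : ℝ → ℂ} (hG : PeriodicIntegrable G) {K : ℝ → ℂ}
    (hK : Continuous K) (A : Set ℝ) :
    AEStronglyMeasurable (fun x => ∫ t in A, K t * (G (x + t) - G x)) volume := by
  have h : AEStronglyMeasurable (fun z : ℝ × ℝ => K z.2 * (G (z.1 + z.2) - G z.1))
      (volume.prod (volume.restrict A)) := by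
    refine ((hK.comp continuous_snd).aestronglyMeasurable).mul ?_
    have := hG.meas_diff.restrict (s := univ ×ˢ A)
    rw [← Measure.prod_restrict, Measure.restrict_univ] at this
    exact this
  exact h.integral_prod_right'

theorem enorm_one_div_two_pi_le : ‖(1 / (2 * Real.pi) : ℂ)‖ₑ ≤ 1 := by
  have h : ‖(1 / (2 * Real.pi) : ℂ)‖ ≤ 1 := by
    rw [show (1 / (2 * Real.pi) : ℂ) = ((1 / (2 * Real.pi) : ℝ) : ℂ) by push_cast; ring,
      Complex.norm_real, Real.norm_of_nonneg (by positivity), div_le_one (by positivity)]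
    linarith [Real.pi_gt_three]
  rw [← ofReal_norm]
  exact ENNReal.ofReal_le_one.2 h

theorem meas_convDiff {G : ℝ → ℂ} (hG : PeriodicIntegrable G) {K : ℝ → ℝ} (hK : Continuous K) :
    AEStronglyMeasurable (convDiff K G) volume :=
  (hG.meas_setIntegral (Complex.continuous_ofReal.comp hK) _).const_mul _

theorem fwdDiff_convDiff {G : ℝ → ℂ} (hG : PeriodicIntegrable G) {K : ℝ → ℝ} (hK : Continuous K)
    (h : ℝ) : fwdDiff h (convDiff K G) = convDiff K (fwdDiff h G) := by
  have hK' : Continuous fun t => (K t : ℂ) := Complex.continuous_ofReal.comp hK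
  funext x
  simp only [fwdDiff, convDiff]
  rw [← mul_sub, ← integral_sub (hG.integrableOn_diff hK' _ _ _) (hG.integrableOn_diff hK' _ _ _)]
  congr 2
  funext t
  rw [show x + t + h = x + h + t by ring]
  ring

theorem convDiff_sum {G : ℝ → ℂ} (hG : PeriodicIntegrable G) {ι : Type*} (s : Finset ι)
    (c : ι → ℝ) {K : ι → ℝ → ℝ} (hK : ∀ i, Continuous (K i)) (x : ℝ) :
    convDiff (fun t => ∑ i ∈ s, c i * K i t) G x = ∑ i ∈ s, (c i : ℂ) * convDiff (K i) G x := by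
  simp only [convDiff]
  have : ∀ t, ((∑ i ∈ s, c i * K i t : ℝ) : ℂ) * (G (x + t) - G x)
      = ∑ i ∈ s, (c i : ℂ) * ((K i t : ℂ) * (G (x + t) - G x)) := fun t => by
    push_cast; rw [Finset.sum_mul]; exact Finset.sum_congr rfl fun i _ => by ring
  simp only [this]
  rw [integral_finsetSum, Finset.mul_sum]
  · refine Finset.sum_congr rfl fun i _ => ?_
    rw [integral_const_mul]; ring
  · intro i _
    exact (hG.integrableOn_diff (Complex.continuous_ofReal.comp (hK i)) _ _ _).const_mul _

theorem convDiff_sub {G : ℝ → ℂ} (hG : PeriodicIntegrable G) {K L : ℝ → ℝ}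
    (hK : Continuous K) (hL : Continuous L) (x : ℝ) :
    convDiff (fun t => K t - L t) G x = convDiff K G x - convDiff L G x := by
  have hK' : Continuous fun t => (K t : ℂ) := Complex.continuous_ofReal.comp hK
  have hL' : Continuous fun t => (L t : ℂ) := Complex.continuous_ofReal.comp hL
  simp only [convDiff]
  rw [← mul_sub, ← integral_sub (hG.integrableOn_diff hK' _ _ _) (hG.integrableOn_diff hL' _ _ _)]
  congr 2
  funext t
  push_cast; ring

/-! ### The modulus of continuity -/

/-- The integral modulus of continuity `sup_{|t| ≤ δ} ‖Δ_t G‖_p`. -/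
noncomputable def modulus (p : ℝ≥0∞) (G : ℝ → ℂ) (δ : ℝ) : ℝ≥0∞ :=
  ⨆ (t : ℝ) (_ : |t| ≤ δ), perNorm p (fwdDiff t G)

/-- The sum `∑_{k = 1}^n ω_p(G, 1/k)`. -/
noncomputable def modulusSum (p : ℝ≥0∞) (G : ℝ → ℂ) (n : ℕ) : ℝ≥0∞ :=
  ∑ k ∈ Finset.range n, modulus p G (1 / (k + 1))

theorem perNorm_fwdDiff_le_modulus {p : ℝ≥0∞} {G : ℝ → ℂ} {t δ : ℝ} (h : |t| ≤ δ) :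
    perNorm p (fwdDiff t G) ≤ modulus p G δ :=
  le_iSup₂ (f := fun t (_ : |t| ≤ δ) => perNorm p (fwdDiff t G)) t h

theorem modulus_mono {p : ℝ≥0∞} {G : ℝ → ℂ} {δ ε : ℝ} (h : δ ≤ ε) :
    modulus p G δ ≤ modulus p G ε :=
  iSup₂_le fun _ ht => perNorm_fwdDiff_le_modulus (ht.trans h)

theorem modulus_natMul_le {p : ℝ≥0∞} (hp : 1 ≤ p) {G : ℝ → ℂ} (hG : PeriodicIntegrable G)
    {N : ℕ} (hN : N ≠ 0) (δ : ℝ) : modulus p G (N * δ) ≤ N * modulus p G δ := by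
  have hN' : (0 : ℝ) < N := by positivity
  refine iSup₂_le fun t ht => ?_
  rw [show t = N * (t / N) by field_simp]
  refine (perNorm_fwdDiff_natMul_le hp hG _ N).trans ?_
  gcongr
  refine perNorm_fwdDiff_le_modulus ?_
  rw [abs_div, abs_of_pos hN', div_le_iff₀ hN']
  linarith

theorem modulusSum_mono {p : ℝ≥0∞} {G : ℝ → ℂ} {m n : ℕ} (h : m ≤ n) :
    modulusSum p G m ≤ modulusSum p G n :=
  Finset.sum_le_sum_of_subset (Finset.range_mono h)

theorem modulus_one_le_modulusSum {p : ℝ≥0∞} {G : ℝ → ℂ} {n : ℕ} (hn : 1 ≤ n) :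
    modulus p G 1 ≤ modulusSum p G n := by
  refine le_trans ?_ (modulusSum_mono hn)
  simp [modulusSum]

theorem natCast_mul_modulus_le {p : ℝ≥0∞} {G : ℝ → ℂ} (n : ℕ) :
    n * modulus p G (1 / n) ≤ modulusSum p G n := by
  have : ∑ _k ∈ Finset.range n, modulus p G (1 / n) = n * modulus p G (1 / n) := by simp
  rw [← this]
  refine Finset.sum_le_sum fun k hk => modulus_mono ?_
  have : (k : ℝ) + 1 ≤ n := by exact_mod_cast Finset.mem_range.1 hk
  exact one_div_le_one_div_of_le (by positivity) this

/-! ### The rate of the Fejér means -/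

theorem perNorm_setIntegral_diff_le {p : ℝ≥0∞} (hp : 1 ≤ p) {G : ℝ → ℂ} (hG : PeriodicIntegrable G)
    {K : ℝ → ℝ} (hK : Continuous K) {A : Set ℝ} (hA : MeasurableSet A) {b v δ : ℝ} (hb : 0 ≤ b)
    (hKb : ∀ t ∈ A, |K t| ≤ b) (hv : volume A ≤ ENNReal.ofReal v) (hδ : ∀ t ∈ A, |t| ≤ δ) :
    perNorm p (fun x => ∫ t in A, (K t : ℂ) * (G (x + t) - G x))
      ≤ ENNReal.ofReal (b * v) * modulus p G δ := by
  refine (perNorm_setIntegral_mul_le hp (Complex.continuous_ofReal.comp hK) hG.meas_diff hA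
    (M := modulus p G δ) fun t ht => perNorm_fwdDiff_le_modulus (hδ t ht)).trans ?_
  gcongr
  calc ∫⁻ t in A, ‖((K t : ℝ) : ℂ)‖ₑ ≤ ∫⁻ _t in A, ENNReal.ofReal b := by
        refine setLIntegral_mono' hA fun t ht => ?_
        rw [← ofReal_norm, Complex.norm_real, Real.norm_eq_abs]
        exact ENNReal.ofReal_le_ofReal (hKb t ht)
    _ = ENNReal.ofReal b * volume A := setLIntegral_const _ _
    _ ≤ ENNReal.ofReal (b * v) := by rw [ENNReal.ofReal_mul hb]; gcongr

/-- The constant in the rate of the Fejér means. -/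
noncomputable def fejerConst : ℝ := 8 * Real.pi ^ 3 + 4 * Real.pi ^ 2 + 2

theorem fejerConst_pos : 0 < fejerConst := by unfold fejerConst; positivity

/-- The period is cut at `|t| = 1/k` for `1 ≤ k ≤ n`. On the piece `1/(k+1) < |t| ≤ 1/k`, of length
about `2/k²`, the kernel is at most `π² (k+1)²` and the differences are at most `ω_p(G, 1/k)`. -/
theorem perNorm_convDiff_dirichletSum_le {p : ℝ≥0∞} (hp : 1 ≤ p) {G : ℝ → ℂ}
    (hG : PeriodicIntegrable G) {n : ℕ} (hn : 1 ≤ n) :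
    perNorm p (convDiff (dirichletSum n) G) ≤ ENNReal.ofReal fejerConst * modulusSum p G n := by
  obtain ⟨N, rfl⟩ : ∃ N, n = N + 1 := ⟨n - 1, by omega⟩
  have hπ := Real.pi_gt_three
  have hK := continuous_dirichletSum (N + 1)
  set K := dirichletSum (N + 1)
  have hK' := Complex.continuous_ofReal.comp hK
  let I : Set ℝ → ℝ → ℂ := fun A x => ∫ t in A, (K t : ℂ) * (G (x + t) - G x)
  have hmeas : ∀ A, AEStronglyMeasurable (I A) volume := fun A => hG.meas_setIntegral hK' A
  let B : ℕ → Set ℝ := fun k => Icc (-(1 / ((k : ℝ) + 1))) (1 / ((k : ℝ) + 1))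
  have hone : ∀ k : ℕ, 1 / ((k : ℝ) + 1) ≤ 1 := fun k => by
    rw [div_le_one (by positivity)]; linarith [Nat.cast_nonneg (α := ℝ) k]
  have hstep : ∀ k : ℕ, 1 / (((k + 1 : ℕ) : ℝ) + 1) ≤ 1 / ((k : ℝ) + 1) := fun k =>
    one_div_le_one_div_of_le (by positivity) (by push_cast; linarith)
  have hBm : ∀ k, MeasurableSet (B k) := fun k => measurableSet_Icc
  have hBπ : ∀ k, B k ⊆ Ioc (-Real.pi) Real.pi := fun k t ht =>
    ⟨by linarith [ht.1, hone k], by linarith [ht.2, hone k]⟩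
  have hBB : ∀ k, B (k + 1) ⊆ B k := fun k =>
    Icc_subset_Icc (neg_le_neg (hstep k)) (hstep k)
  have hint : ∀ x, IntegrableOn (fun t => (K t : ℂ) * (G (x + t) - G x))
      (Ioc (-Real.pi) Real.pi) := fun x => hG.integrableOn_diff hK' x _ _
  have hdec : convDiff K G = fun x => (1 / (2 * Real.pi) : ℂ) *
      (I (Ioc (-Real.pi) Real.pi \ B 0) x
        + (∑ k ∈ Finset.range N, I (B k \ B (k + 1)) x + I (B N) x)) := by
    funext x
    have h1 : ∀ k, I (B k \ B (k + 1)) x = I (B k) x - I (B (k + 1)) x := fun k =>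
      setIntegral_sdiff (hBm _) ((hint x).mono_set (hBπ k)) (hBB k)
    have h2 : I (Ioc (-Real.pi) Real.pi \ B 0) x = I (Ioc (-Real.pi) Real.pi) x - I (B 0) x :=
      setIntegral_sdiff (hBm _) (hint x) (hBπ 0)
    simp only [h1, h2]
    rw [Finset.sum_range_sub']
    simp only [convDiff, I]
    ring
  -- away from the origin the kernel is at most `π² / t²`
  have hKt : ∀ {s t : ℝ}, 0 < s → s ≤ |t| → |t| ≤ Real.pi → |K t| ≤ Real.pi ^ 2 / s ^ 2 := by
    intro s t hs hst ht
    obtain ⟨h1, h2⟩ := dirichletSum_nonneg_and_le (N + 1) (abs_pos.1 (hs.trans_le hst)) ht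
    rw [abs_of_nonneg h1]
    refine h2.trans ?_
    rw [← sq_abs t]
    gcongr
  have hout : perNorm p (I (Ioc (-Real.pi) Real.pi \ B 0))
      ≤ ENNReal.ofReal (8 * Real.pi ^ 3) * modulusSum p G (N + 1) := by
    have h1 : ∀ t ∈ Ioc (-Real.pi) Real.pi \ B 0, 1 ≤ |t| ∧ |t| ≤ Real.pi := by
      rintro t ⟨ht, htB⟩
      refine ⟨?_, abs_le.2 ⟨ht.1.le, ht.2⟩⟩
      by_contra! hlt
      exact htB (by simpa [B] using abs_le.1 hlt.le)
    refine (perNorm_setIntegral_diff_le hp hG hK (measurableSet_Ioc.diff (hBm 0))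
      (b := Real.pi ^ 2 / 1 ^ 2) (v := 2 * Real.pi) (δ := Real.pi) (by positivity)
      (fun t ht => hKt one_pos (h1 t ht).1 (h1 t ht).2) ?_ (fun t ht => (h1 t ht).2)).trans ?_
    · refine (measure_mono sdiff_subset).trans ?_
      rw [Real.volume_Ioc]
      exact ENNReal.ofReal_le_ofReal (by linarith)
    · have h4 : modulus p G Real.pi ≤ (4 : ℕ) * modulusSum p G (N + 1) :=
        calc modulus p G Real.pi ≤ modulus p G ((4 : ℕ) * 1) :=
              modulus_mono (by push_cast; linarith [Real.pi_le_four])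
          _ ≤ (4 : ℕ) * modulus p G 1 := modulus_natMul_le hp hG (by norm_num) 1
          _ ≤ _ := by gcongr; exact modulus_one_le_modulusSum (by omega)
      refine (mul_le_mul_right h4 _).trans_eq ?_
      rw [← mul_assoc, show ((4 : ℕ) : ℝ≥0∞) = ENNReal.ofReal 4 by simp,
        ← ENNReal.ofReal_mul (by positivity)]
      congr 2; ring
  have hmid : ∀ k, perNorm p (I (B k \ B (k + 1)))
      ≤ ENNReal.ofReal (4 * Real.pi ^ 2) * modulus p G (1 / (k + 1)) := by
    intro k
    have h1 : ∀ t ∈ B k \ B (k + 1), 1 / ((k : ℝ) + 2) ≤ |t| ∧ |t| ≤ 1 / ((k : ℝ) + 1) := by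
      rintro t ⟨ht, htB⟩
      refine ⟨?_, abs_le.2 ht⟩
      by_contra! hlt
      refine htB (abs_le.1 (hlt.le.trans_eq ?_))
      push_cast; ring
    refine (perNorm_setIntegral_diff_le hp hG hK ((hBm k).diff (hBm (k + 1)))
      (b := Real.pi ^ 2 / (1 / ((k : ℝ) + 2)) ^ 2)
      (v := 2 * (1 / ((k : ℝ) + 1) - 1 / ((k : ℝ) + 2))) (δ := 1 / (k + 1)) (by positivity)
      (fun t ht => hKt (by positivity) (h1 t ht).1 ((h1 t ht).2.trans (by linarith [hone k])))
      ?_ (fun t ht => (h1 t ht).2)).trans ?_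
    · rw [measure_sdiff (hBB k) (hBm _).nullMeasurableSet (by simp [B]), Real.volume_Icc,
        Real.volume_Icc, ← ENNReal.ofReal_sub _ (by
          have : (0 : ℝ) ≤ 1 / (((k + 1 : ℕ) : ℝ) + 1) := by positivity
          linarith)]
      refine ENNReal.ofReal_le_ofReal (le_of_eq ?_)
      push_cast; ring
    · refine mul_le_mul_left (ENNReal.ofReal_le_ofReal ?_) _
      have e : Real.pi ^ 2 / (1 / ((k : ℝ) + 2)) ^ 2 * (2 * (1 / ((k : ℝ) + 1) - 1 / ((k : ℝ) + 2)))
          = 2 * Real.pi ^ 2 * ((k + 2) / (k + 1)) := by field_simp; ring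
      have h2 : ((k : ℝ) + 2) / (k + 1) ≤ 2 := by
        rw [div_le_iff₀ (by positivity)]; linarith [Nat.cast_nonneg (α := ℝ) k]
      rw [e]
      nlinarith [sq_nonneg Real.pi]
  have hin : perNorm p (I (B N)) ≤ ENNReal.ofReal 2 * modulusSum p G (N + 1) := by
    refine (perNorm_setIntegral_diff_le hp hG hK (hBm N) (b := ((N : ℝ) + 1) ^ 2)
      (v := 2 * (1 / ((N : ℝ) + 1))) (δ := 1 / (N + 1)) (by positivity)
      (fun t _ => by simpa using abs_dirichletSum_le (N + 1) t) ?_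
      (fun t ht => abs_le.2 ht)).trans ?_
    · rw [Real.volume_Icc]
      exact ENNReal.ofReal_le_ofReal (by linarith)
    · have e : ((N : ℝ) + 1) ^ 2 * (2 * (1 / ((N : ℝ) + 1))) = 2 * ((N + 1 : ℕ) : ℝ) := by
        push_cast; field_simp
      have h := natCast_mul_modulus_le (p := p) (G := G) (N + 1)
      push_cast at h
      rw [e, ENNReal.ofReal_mul two_pos.le, ENNReal.ofReal_natCast, mul_assoc]
      push_cast
      gcongr
  have hsum : perNorm p (fun x => ∑ k ∈ Finset.range N, I (B k \ B (k + 1)) x)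
      ≤ ENNReal.ofReal (4 * Real.pi ^ 2) * modulusSum p G (N + 1) :=
    calc _ ≤ ∑ k ∈ Finset.range N, perNorm p (I (B k \ B (k + 1))) :=
          perNorm_sum_le hp _ fun k _ => hmeas _
      _ ≤ ∑ k ∈ Finset.range N, ENNReal.ofReal (4 * Real.pi ^ 2) * modulus p G (1 / (k + 1)) :=
          Finset.sum_le_sum fun k _ => hmid k
      _ = ENNReal.ofReal (4 * Real.pi ^ 2) * modulusSum p G N := by
          rw [modulusSum, Finset.mul_sum]
      _ ≤ _ := by gcongr; exact modulusSum_mono (by omega)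
  have hms : AEStronglyMeasurable (fun x => ∑ k ∈ Finset.range N, I (B k \ B (k + 1)) x)
      volume := by
    have := Finset.aestronglyMeasurable_sum (Finset.range N) (f := fun k => I (B k \ B (k + 1)))
      (μ := volume) fun k _ => hmeas _
    exact this.congr (Filter.Eventually.of_forall fun x => by simp)
  rw [hdec, perNorm_const_mul]
  calc _ ≤ 1 * perNorm p (fun x => I (Ioc (-Real.pi) Real.pi \ B 0) x
        + (∑ k ∈ Finset.range N, I (B k \ B (k + 1)) x + I (B N) x)) := by
        gcongr; exact enorm_one_div_two_pi_le
    _ ≤ ENNReal.ofReal (8 * Real.pi ^ 3) * modulusSum p G (N + 1)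
        + (ENNReal.ofReal (4 * Real.pi ^ 2) * modulusSum p G (N + 1)
          + ENNReal.ofReal 2 * modulusSum p G (N + 1)) := by
        rw [one_mul]
        refine (perNorm_add_le hp (hmeas _) (hms.add (hmeas _))).trans (add_le_add hout ?_)
        exact (perNorm_add_le hp hms (hmeas _)).trans (add_le_add hsum hin)
    _ = _ := by
        rw [← add_mul, ← add_mul, ← ENNReal.ofReal_add (by positivity) two_pos.le,
          ← ENNReal.ofReal_add (by positivity) (by positivity), fejerConst, add_assoc]

/-- A kernel whose weights have small second differences inherits the rate of the Fejér means. -/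
theorem perNorm_convDiff_evenKernel_le {p : ℝ≥0∞} (hp : 1 ≤ p) {G : ℝ → ℂ}
    (hG : PeriodicIntegrable G) {a : ℕ → ℝ} {n : ℕ} (h0 : a n = 0) (h1 : a (n + 1) = 0) {B : ℝ}
    (hB : ∑ j ∈ Finset.range n, |secondDiff a j| ≤ B) :
    perNorm p (convDiff (evenKernel a n) G)
      ≤ ENNReal.ofReal (B * fejerConst) * modulusSum p G n := by
  have e : convDiff (evenKernel a n) G = fun x => ∑ j ∈ Finset.range n,
      (secondDiff a j : ℂ) * convDiff (dirichletSum (j + 1)) G x := by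
    funext x
    rw [← convDiff_sum hG _ _ (fun j => continuous_dirichletSum (j + 1))]
    congr 1
    funext t
    exact evenKernel_eq_sum_dirichletSum h0 h1 t
  have hB0 : 0 ≤ B := (Finset.sum_nonneg fun _ _ => abs_nonneg _).trans hB
  rw [e]
  calc _ ≤ ∑ j ∈ Finset.range n,
        perNorm p (fun x => (secondDiff a j : ℂ) * convDiff (dirichletSum (j + 1)) G x) :=
        perNorm_sum_le hp _ fun j _ => (meas_convDiff hG (continuous_dirichletSum _)).const_mul _
    _ ≤ ∑ j ∈ Finset.range n, ENNReal.ofReal |secondDiff a j| *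
        (ENNReal.ofReal fejerConst * modulusSum p G n) := by
        refine Finset.sum_le_sum fun j hj => ?_
        rw [perNorm_const_mul, ← ofReal_norm, Complex.norm_real, Real.norm_eq_abs]
        gcongr
        refine (perNorm_convDiff_dirichletSum_le hp hG (by omega)).trans ?_
        gcongr
        exact modulusSum_mono (Finset.mem_range.1 hj)
    _ = ENNReal.ofReal (∑ j ∈ Finset.range n, |secondDiff a j|) *
        (ENNReal.ofReal fejerConst * modulusSum p G n) := by
        rw [ENNReal.ofReal_sum_of_nonneg fun _ _ => abs_nonneg _, Finset.sum_mul]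
    _ ≤ ENNReal.ofReal B * (ENNReal.ofReal fejerConst * modulusSum p G n) := by gcongr
    _ = _ := by rw [← mul_assoc, ← ENNReal.ofReal_mul hB0]

/-! ### Fourier multipliers -/

/-- The exponential `x ↦ e^{ikx}`. -/
noncomputable def mode (k : ℤ) (x : ℝ) : ℂ := Complex.exp (Complex.I * k * x)

theorem continuous_mode (k : ℤ) : Continuous (mode k) := by unfold mode; fun_prop

theorem mode_add (k : ℤ) (x y : ℝ) : mode k (x + y) = mode k x * mode k y := by
  simp only [mode, ← Complex.exp_add]; push_cast; ring_nf

theorem mode_add_index (k l : ℤ) (x : ℝ) : mode (k + l) x = mode k x * mode l x := by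
  simp only [mode, ← Complex.exp_add]; push_cast; ring_nf

theorem mode_zero_index (x : ℝ) : mode 0 x = 1 := by simp [mode]

theorem mode_periodic (k : ℤ) : Function.Periodic (mode k) (2 * Real.pi) := fun x => by
  rw [mode_add]
  have : mode k (2 * Real.pi) = 1 := by
    rw [mode, Complex.exp_eq_one_iff]
    exact ⟨k, by push_cast; ring⟩
  rw [this, mul_one]

theorem mode_periodicIntegrable (k : ℤ) : PeriodicIntegrable (mode k) :=
  .of_continuous (mode_periodic k) (continuous_mode k)

theorem integral_mode {k : ℤ} (hk : k ≠ 0) : ∫ t in Ioc (-Real.pi) Real.pi, mode k t = 0 := by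
  have hπ := Real.pi_pos
  rw [← intervalIntegral.integral_of_le (by linarith)]
  have hc : Complex.I * k ≠ 0 := mul_ne_zero Complex.I_ne_zero (by exact_mod_cast hk)
  have h := integral_exp_mul_complex (a := -Real.pi) (b := Real.pi) hc
  have h2 := mode_periodic k (-Real.pi)
  rw [show -Real.pi + 2 * Real.pi = Real.pi by ring] at h2
  simp only [mode] at h2 ⊢
  rw [h, h2, sub_self, zero_div]

theorem perConv_mode_mode (k l : ℤ) :
    perConv (mode (-k)) (mode l) 0 = if k = l then 1 else 0 := by
  simp only [perConv, zero_add, ← mode_add_index]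
  split_ifs with h
  · subst h
    have : ((1 / (2 * Real.pi) : ℝ) * (2 * Real.pi) : ℝ) = 1 := by
      have := Real.pi_pos; field_simp
    simp only [neg_add_cancel, mode_zero_index]
    rw [← intervalIntegral.integral_of_le (by linarith [Real.pi_pos]),
      intervalIntegral.integral_const]
    simp only [sub_neg_eq_add, ← two_mul, Complex.real_smul, mul_one]
    exact_mod_cast this
  · rw [integral_mode (by omega), mul_zero]

theorem perConv_mode {G : ℝ → ℂ} (hG : PeriodicIntegrable G) (k : ℤ) (x : ℝ) :
    perConv (mode (-k)) G x = perConv (mode (-k)) G 0 * mode k x := by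
  have hπ := Real.pi_pos
  have hper : Function.Periodic (fun u => mode (-k) u * G u) (2 * Real.pi) := fun u => by
    simp only [mode_periodic (-k) u, hG.periodic u]
  have h1 : ∀ t, mode (-k) t * G (x + t)
      = mode k x * (fun u => mode (-k) u * G u) (t + x) := fun t => by
    have : mode k x * mode (-k) x = 1 := by rw [← mode_add_index, add_neg_cancel, mode_zero_index]
    simp only [mode_add]
    rw [add_comm x t]
    linear_combination (- mode (-k) t * G (t + x)) * this
  simp only [perConv, h1]
  rw [integral_const_mul, ← intervalIntegral.integral_of_le (by linarith),
    ← intervalIntegral.integral_of_le (by linarith),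
    intervalIntegral.integral_comp_add_right (fun u => mode (-k) u * G u)]
  have h2 := hper.intervalIntegral_add_eq (-Real.pi + x) (-Real.pi)
  rw [show -Real.pi + x + 2 * Real.pi = Real.pi + x by ring,
    show -Real.pi + 2 * Real.pi = Real.pi by ring] at h2
  rw [h2]
  simp only [zero_add]
  ring

theorem coeff_eq_perConv {f : ℝ → ℝ} (hf : Function.Periodic f (2 * Real.pi)) (k : ℤ) :
    coeff f k = perConv (mode (-k)) (fun x => (f x : ℂ)) 0 := by
  have hπ := Real.pi_pos
  have hper : Function.Periodic (fun u => mode (-k) u * (f u : ℂ)) (2 * Real.pi) := fun u => by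
    simp only [mode_periodic (-k) u, hf u]
  rw [coeff, fourierCoeffOn_eq_integral]
  have h2 := hper.intervalIntegral_add_eq 0 (-Real.pi)
  rw [show -Real.pi + 2 * Real.pi = Real.pi by ring, zero_add] at h2
  simp only [perConv, zero_add]
  rw [← intervalIntegral.integral_of_le (by linarith), ← h2, sub_zero, Complex.real_smul]
  congr 1
  · push_cast; ring
  · refine intervalIntegral.integral_congr fun t _ => ?_
    simp only [fourier_coe_apply, smul_eq_mul, mode]
    congr 2
    have : (Real.pi : ℂ) ≠ 0 := by exact_mod_cast hπ.ne'
    push_cast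
    field_simp

theorem sum_Icc_neg_succ {M : Type*} [AddCommMonoid M] (g : ℤ → M) (n : ℕ) :
    ∑ k ∈ Finset.Icc (-((n + 1 : ℕ) : ℤ)) ((n + 1 : ℕ) : ℤ), g k
      = (g (-((n + 1 : ℕ) : ℤ)) + g ((n + 1 : ℕ) : ℤ))
        + ∑ k ∈ Finset.Icc (-(n : ℤ)) (n : ℤ), g k := by
  have h : Finset.Icc (-((n + 1 : ℕ) : ℤ)) ((n + 1 : ℕ) : ℤ)
      = insert (-((n + 1 : ℕ) : ℤ)) (insert ((n + 1 : ℕ) : ℤ) (Finset.Icc (-(n : ℤ)) (n : ℤ))) := by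
    ext k; simp only [Finset.mem_Icc, Finset.mem_insert]; omega
  rw [h, Finset.sum_insert, Finset.sum_insert, add_assoc]
  · simp
  · simp only [Finset.mem_insert, Finset.mem_Icc]; omega

theorem evenKernel_eq_sum_mode (a : ℕ → ℝ) (n : ℕ) (t : ℝ) :
    (evenKernel a n t : ℂ)
      = ∑ k ∈ Finset.Icc (-(n : ℤ)) (n : ℤ), (a k.natAbs : ℂ) * mode (-k) t := by
  induction n with
  | zero => simp [evenKernel, mode_zero_index]
  | succ n ih =>
    rw [sum_Icc_neg_succ, ← ih, evenKernel_succ]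
    have : (2 : ℂ) * Complex.cos ((n + 1) * t) = mode ((n + 1 : ℕ) : ℤ) t
        + mode (-((n + 1 : ℕ) : ℤ)) t := by
      rw [Complex.two_cos, mode, mode]
      push_cast
      ring_nf
    simp only [Int.natAbs_neg, Int.natAbs_natCast, neg_neg]
    push_cast at this ⊢
    linear_combination (a (n + 1) : ℂ) * this

theorem perConv_evenKernel {G : ℝ → ℂ} (hG : PeriodicIntegrable G) (a : ℕ → ℝ) (n : ℕ) (x : ℝ) :
    perConv (fun t => (evenKernel a n t : ℂ)) G x = ∑ k ∈ Finset.Icc (-(n : ℤ)) (n : ℤ),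
      (a k.natAbs : ℂ) * perConv (mode (-k)) G 0 * mode k x := by
  have h : ∀ k, (a k.natAbs : ℂ) * perConv (mode (-k)) G 0 * mode k x
      = (1 / (2 * Real.pi) : ℂ) * ∫ t in Ioc (-Real.pi) Real.pi,
        (a k.natAbs : ℂ) * (mode (-k) t * G (x + t)) := fun k => by
    rw [mul_assoc, ← perConv_mode hG, perConv, integral_const_mul]; ring
  simp only [h]
  rw [← Finset.mul_sum, ← integral_finsetSum]
  · simp only [perConv]
    congr 2
    funext t
    rw [evenKernel_eq_sum_mode, Finset.sum_mul]
    exact Finset.sum_congr rfl fun k _ => by ring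
  · exact fun k _ => (hG.integrableOn_mul (continuous_mode _) x _ _).const_mul _

theorem perConv_one_evenKernel (a : ℕ → ℝ) (n : ℕ) (x : ℝ) :
    perConv (fun t => (evenKernel a n t : ℂ)) (fun _ => 1) x = a 0 := by
  have e : (fun _ : ℝ => (1 : ℂ)) = mode 0 := by funext x; rw [mode_zero_index]
  rw [e, perConv_evenKernel (mode_periodicIntegrable 0)]
  simp only [perConv_mode_mode]
  rw [Finset.sum_eq_single 0]
  · simp [mode_zero_index]
  · intro k _ hk; simp [hk]
  · intro h; exact absurd (by simp) h

theorem convDiff_evenKernel {G : ℝ → ℂ} (hG : PeriodicIntegrable G) (a : ℕ → ℝ) (n : ℕ) (x : ℝ) :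
    convDiff (evenKernel a n) G x
      = perConv (fun t => (evenKernel a n t : ℂ)) G x - a 0 * G x := by
  have hK : Continuous fun t => (evenKernel a n t : ℂ) :=
    Complex.continuous_ofReal.comp (continuous_evenKernel a n)
  have h1 := perConv_one_evenKernel a n x
  have hc : Continuous fun t => (evenKernel a n t : ℂ) * G x := hK.mul continuous_const
  rw [← h1]
  simp only [perConv, convDiff, mul_sub, mul_one]
  rw [integral_sub (hG.integrableOn_mul hK x _ _)
    (hc.integrableOn_Icc.mono_set Ioc_subset_Icc_self), integral_mul_const]
  ring

theorem perConv_evenKernel_periodicIntegrable {G : ℝ → ℂ} (hG : PeriodicIntegrable G)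
    (a : ℕ → ℝ) (n : ℕ) : PeriodicIntegrable (perConv (fun t => (evenKernel a n t : ℂ)) G) := by
  have e : perConv (fun t => (evenKernel a n t : ℂ)) G = fun x =>
      ∑ k ∈ Finset.Icc (-(n : ℤ)) (n : ℤ),
        (a k.natAbs : ℂ) * perConv (mode (-k)) G 0 * mode k x := by
    funext x; exact perConv_evenKernel hG a n x
  rw [e]
  refine .of_continuous (fun x => ?_) ?_
  · exact Finset.sum_congr rfl fun l _ => by rw [mode_periodic l x]
  · exact continuous_finsetSum _ fun l _ => continuous_const.mul (continuous_mode l)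

/-- Convolutions with kernels of disjoint spectrum annihilate each other. -/
theorem perConv_perConv_eq_zero {G : ℝ → ℂ} (hG : PeriodicIntegrable G) {a b : ℕ → ℝ}
    (hab : ∀ k, a k * b k = 0) (n m : ℕ) (x : ℝ) :
    perConv (fun t => (evenKernel a n t : ℂ))
      (perConv (fun t => (evenKernel b m t : ℂ)) G) x = 0 := by
  set H := perConv (fun t => (evenKernel b m t : ℂ)) G with hH
  have hHeq : H = fun x => ∑ l ∈ Finset.Icc (-(m : ℤ)) (m : ℤ),
      ((b l.natAbs : ℂ) * perConv (mode (-l)) G 0) * mode l x := by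
    funext x; exact perConv_evenKernel hG b m x
  have hHp : PeriodicIntegrable H := perConv_evenKernel_periodicIntegrable hG b m
  rw [perConv_evenKernel hHp]
  refine Finset.sum_eq_zero fun k _ => ?_
  have hk : perConv (mode (-k)) H 0 = ∑ l ∈ Finset.Icc (-(m : ℤ)) (m : ℤ),
      ((b l.natAbs : ℂ) * perConv (mode (-l)) G 0) * perConv (mode (-k)) (mode l) 0 := by
    rw [hHeq]
    simp only [perConv, zero_add, Finset.mul_sum]
    rw [integral_finsetSum, Finset.mul_sum]
    · refine Finset.sum_congr rfl fun l _ => ?_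
      have : ∀ t, mode (-k) t * ((b l.natAbs : ℂ) * (1 / (2 * Real.pi) *
          ∫ t in Ioc (-Real.pi) Real.pi, mode (-l) t * G t) * mode l t)
          = ((b l.natAbs : ℂ) * (1 / (2 * Real.pi) *
          ∫ t in Ioc (-Real.pi) Real.pi, mode (-l) t * G t)) * (mode (-k) t * mode l t) :=
        fun t => by ring
      simp only [this]
      rw [integral_const_mul]; ring
    · intro l _
      have hc : Continuous fun t => mode (-k) t * ((b l.natAbs : ℂ) * (1 / (2 * Real.pi) *
          ∫ t in Ioc (-Real.pi) Real.pi, mode (-l) t * G t) * mode l t) :=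
        (continuous_mode _).mul (continuous_const.mul (continuous_mode _))
      exact hc.integrableOn_Icc.mono_set Ioc_subset_Icc_self
  rw [hk]
  simp only [perConv_mode_mode]
  have hz : (a k.natAbs : ℂ) * b k.natAbs = 0 := by exact_mod_cast hab k.natAbs
  rw [Finset.mul_sum, Finset.sum_mul]
  refine Finset.sum_eq_zero fun l _ => ?_
  split_ifs with h
  · subst h; linear_combination (perConv (mode (-k)) G 0 * mode k x) * hz
  · simp

/-! ### The Riesz and Fejér means -/

/-- The weights `(1 - k/n)_+^γ` of the Riesz mean. -/
noncomputable def rieszWeight (γ : ℝ) (n k : ℕ) : ℝ := (max (1 - (k : ℝ) / n) 0) ^ γ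

theorem rieszWeight_zero (γ : ℝ) (n : ℕ) : rieszWeight γ n 0 = 1 := by simp [rieszWeight]

theorem rieszWeight_of_le {γ : ℝ} {n k : ℕ} (hn : 1 ≤ n) (h : k ≤ n) :
    rieszWeight γ n k = (1 - (k : ℝ) / n) ^ γ := by
  have hn' : (0 : ℝ) < n := by exact_mod_cast hn
  rw [rieszWeight, max_eq_left]
  rw [sub_nonneg, div_le_one hn']
  exact_mod_cast h

theorem rieszWeight_of_ge {γ : ℝ} (hγ : 0 < γ) {n k : ℕ} (hn : 1 ≤ n) (h : n ≤ k) :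
    rieszWeight γ n k = 0 := by
  have hn' : (0 : ℝ) < n := by exact_mod_cast hn
  rw [rieszWeight, max_eq_right, Real.zero_rpow hγ.ne']
  rw [sub_nonpos, one_le_div hn']
  exact_mod_cast h

theorem rieszMean_eq_sum {γ : ℝ} {n : ℕ} (hn : 1 ≤ n) (f : ℝ → ℝ) (x : ℝ) :
    rieszMean γ n f x = ∑ k ∈ Finset.Icc (-(n : ℤ)) (n : ℤ),
      (rieszWeight γ n k.natAbs : ℂ) * coeff f k * mode k x := by
  refine Finset.sum_congr rfl fun k hk => ?_
  have hk := Finset.mem_Icc.1 hk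
  rw [rieszWeight_of_le hn (by omega), Nat.cast_natAbs, mode]
  push_cast
  rfl

theorem rieszMean_sub_eq {γ : ℝ} {n : ℕ} (hn : 1 ≤ n) {f : ℝ → ℝ}
    (hf : PeriodicIntegrable fun x => (f x : ℂ)) :
    (fun x => rieszMean γ n f x - (f x : ℂ))
      = convDiff (evenKernel (rieszWeight γ n) n) (fun x => (f x : ℂ)) := by
  have hf' : Function.Periodic f (2 * Real.pi) := fun x => by
    have := hf.periodic x
    simpa using this
  funext x
  rw [convDiff_evenKernel hf, perConv_evenKernel hf, rieszMean_eq_sum hn, rieszWeight_zero]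
  simp only [coeff_eq_perConv hf', Complex.ofReal_one, one_mul]

/-- The Fejér mean is the Riesz mean of exponent one: the frequency `k` occurs in the partial sums
of order `|k|, …, n - 1`. -/
theorem rieszMean_one_eq_fejerMean (f : ℝ → ℝ) {n : ℕ} (hn : 1 ≤ n) :
    rieszMean 1 n f = fejerMean n f := by
  have hn' : (n : ℂ) ≠ 0 := by exact_mod_cast (by omega : n ≠ 0)
  funext x
  simp only [fejerMean, partialSum, rieszMean, Real.rpow_one]
  have h1 : ∀ m ∈ Finset.range n,
      ∑ k ∈ Finset.Icc (-(m : ℤ)) (m : ℤ), coeff f k * Complex.exp (Complex.I * k * x)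
      = ∑ k ∈ Finset.Icc (-(n : ℤ)) (n : ℤ),
        if k.natAbs ≤ m then coeff f k * Complex.exp (Complex.I * k * x) else 0 := by
    intro m hm
    have hm := Finset.mem_range.1 hm
    rw [← Finset.sum_filter]
    refine Finset.sum_congr ?_ fun _ _ => rfl
    ext k; simp only [Finset.mem_Icc, Finset.mem_filter]; omega
  rw [Finset.sum_congr rfl h1, Finset.sum_comm, Finset.mul_sum]
  refine Finset.sum_congr rfl fun k hk => ?_
  have hk := Finset.mem_Icc.1 hk
  rw [← Finset.sum_filter, Finset.sum_const, nsmul_eq_mul]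
  have hcard : (Finset.filter (fun m => k.natAbs ≤ m) (Finset.range n)).card = n - k.natAbs := by
    have : Finset.filter (fun m => k.natAbs ≤ m) (Finset.range n) = Finset.Ico k.natAbs n := by
      ext m; simp only [Finset.mem_filter, Finset.mem_range, Finset.mem_Ico]; omega
    rw [this, Nat.card_Ico]
  rw [hcard, Nat.cast_sub (by omega)]
  have habs : (|(k : ℝ)| : ℝ) = (k.natAbs : ℝ) := by rw [Nat.cast_natAbs]; push_cast; rfl
  rw [habs]
  push_cast
  field_simp

/-! ### Uniform boundedness for concave weights -/

/-- The bound for the `L¹` norm of the kernels with concave weights dominated by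
`c (1 - k/n)^γ`. -/
noncomputable def concaveKernelConst (γ c : ℝ) : ℝ :=
  2 * (2 + c * (Real.pi + Real.pi ^ 2) * (1 + Real.pi) ^ γ / γ)

/-- The kernel is at most `2n` for `|t| ≤ 1/n` and at most a constant times
`n^{-γ} |t|^{-1-γ}` beyond, so that its `L¹` norm is bounded uniformly in `n`. -/
theorem ConcaveWeights.lintegral_evenKernel_le {a : ℕ → ℝ} {n : ℕ} (h : ConcaveWeights a n)
    (hn : 1 ≤ n) {γ c : ℝ} (hγ : 0 < γ) (hc : 0 ≤ c)
    (ha : ∀ k ≤ n, a k ≤ c * rieszWeight γ n k) :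
    ∫⁻ t in Ioc (-Real.pi) Real.pi, ‖(evenKernel a n t : ℂ)‖ₑ
      ≤ ENNReal.ofReal (concaveKernelConst γ c) := by
  have hπ := Real.pi_gt_three
  have hn0 : (0 : ℝ) < n := by exact_mod_cast hn
  have hn1 : 1 / (n : ℝ) ≤ 1 := by
    rw [div_le_one hn0]; exact_mod_cast hn
  set K := evenKernel a n
  have hKc : Continuous fun t => |K t| := (continuous_evenKernel a n).abs
  set M := c * (Real.pi + Real.pi ^ 2) * (1 + Real.pi) ^ γ with hM
  have hM0 : 0 ≤ M := by positivity
  have hpt : ∀ t : ℝ, 1 / (n : ℝ) ≤ t → t ≤ Real.pi →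
      |K t| ≤ M * (n : ℝ) ^ (-γ) * t ^ (-1 - γ) := by
    intro t ht1 ht2
    have ht0 : 0 < t := lt_of_lt_of_le (by positivity) ht1
    have hl : ⌈1 / t⌉₊ ≤ n := by
      rw [Nat.ceil_le, div_le_iff₀ ht0]
      rwa [div_le_iff₀ hn0, mul_comm] at ht1
    have hl1 : 1 ≤ (⌈1 / t⌉₊ : ℝ) * |t| := by
      rw [abs_of_pos ht0, ← div_le_iff₀ ht0]; exact Nat.le_ceil _
    have hl2 : (⌈1 / t⌉₊ : ℝ) ≤ (1 + Real.pi) / t := by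
      refine (Nat.ceil_lt_add_one (by positivity)).le.trans ?_
      rw [div_add_one ht0.ne']
      gcongr
    have h1 := h.abs_evenKernel_le_div hl ht0.ne' (by rwa [abs_of_pos ht0]) hl1
    rw [abs_of_pos ht0] at h1
    have h2 := ha (n - ⌈1 / t⌉₊) (by omega)
    rw [rieszWeight_of_le hn (by omega), Nat.cast_sub hl] at h2
    have h3 : 1 - ((n : ℝ) - ⌈1 / t⌉₊) / n = ⌈1 / t⌉₊ / n := by field_simp; ring
    rw [h3] at h2
    have h4 : ((⌈1 / t⌉₊ : ℝ) / n) ^ γ ≤ ((1 + Real.pi) / t / n) ^ γ :=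
      Real.rpow_le_rpow (by positivity) (by gcongr) hγ.le
    have h5 : ((1 + Real.pi) / t / n) ^ γ = (1 + Real.pi) ^ γ * t ^ (-γ) * (n : ℝ) ^ (-γ) := by
      rw [Real.div_rpow (by positivity) hn0.le, Real.div_rpow (by positivity) ht0.le,
        Real.rpow_neg ht0.le, Real.rpow_neg hn0.le]
      ring
    have h6 : t ^ (-1 - γ) = t ^ (-γ) / t := by
      rw [show -1 - γ = -γ - 1 by ring, Real.rpow_sub_one ht0.ne']
    calc |K t| ≤ a (n - ⌈1 / t⌉₊) * ((Real.pi + Real.pi ^ 2) / t) := h1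
      _ ≤ (c * ((1 + Real.pi) ^ γ * t ^ (-γ) * (n : ℝ) ^ (-γ)))
            * ((Real.pi + Real.pi ^ 2) / t) := by
          gcongr
          exact h2.trans (mul_le_mul_of_nonneg_left (h4.trans_eq h5) hc)
      _ = M * (n : ℝ) ^ (-γ) * t ^ (-1 - γ) := by rw [h6, hM]; ring
  have hI1 : ∫ t in (0 : ℝ)..(1 / n), |K t| ≤ 2 := by
    calc _ ≤ ∫ _t in (0 : ℝ)..(1 / n), (2 * n : ℝ) :=
          intervalIntegral.integral_mono_on (by positivity) (hKc.intervalIntegrable _ _)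
            intervalIntegrable_const fun t _ => h.abs_evenKernel_le t
      _ = 2 := by
          rw [intervalIntegral.integral_const, smul_eq_mul]; field_simp; ring
  have hI2 : ∫ t in (1 / n : ℝ)..Real.pi, |K t| ≤ M / γ := by
    have h0 : (0 : ℝ) ∉ uIcc (1 / n : ℝ) Real.pi := by
      rw [uIcc_of_le (by linarith)]
      intro h; have : (0 : ℝ) < 1 / n := by positivity
      linarith [h.1]
    calc _ ≤ ∫ t in (1 / n : ℝ)..Real.pi, M * (n : ℝ) ^ (-γ) * t ^ (-1 - γ) := by
          refine intervalIntegral.integral_mono_on (by linarith) (hKc.intervalIntegrable _ _)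
            ?_ fun t ht => hpt t ht.1 ht.2
          exact (intervalIntegral.intervalIntegrable_rpow (Or.inr h0)).const_mul _
      _ = M * (n : ℝ) ^ (-γ) * (((n : ℝ) ^ γ - Real.pi ^ (-γ)) / γ) := by
          rw [intervalIntegral.integral_const_mul, integral_rpow (Or.inr ⟨by linarith, h0⟩),
            show -1 - γ + 1 = -γ by ring, one_div, Real.inv_rpow hn0.le,
            Real.rpow_neg hn0.le, inv_inv, div_neg, ← neg_div, neg_sub]
      _ ≤ M * (n : ℝ) ^ (-γ) * ((n : ℝ) ^ γ / γ) := by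
          gcongr
          have : 0 ≤ Real.pi ^ (-γ) := by positivity
          linarith
      _ = M / γ := by
          have : (n : ℝ) ^ (-γ) * (n : ℝ) ^ γ = 1 := by
            rw [← Real.rpow_add hn0, neg_add_cancel, Real.rpow_zero]
          linear_combination (M / γ) * this
  have hI : ∫ t in (-Real.pi)..Real.pi, |K t| ≤ concaveKernelConst γ c := by
    have e1 : ∫ t in (-Real.pi)..0, |K t| = ∫ t in (0 : ℝ)..Real.pi, |K t| := by
      have := intervalIntegral.integral_comp_neg (a := 0) (b := Real.pi) fun t => |K t|
      simp only [K, evenKernel_neg, neg_zero] at this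
      exact this.symm
    rw [← intervalIntegral.integral_add_adjacent_intervals (hKc.intervalIntegrable _ 0)
      (hKc.intervalIntegrable 0 _), e1,
      ← intervalIntegral.integral_add_adjacent_intervals (hKc.intervalIntegrable _ (1 / (n : ℝ)))
      (hKc.intervalIntegrable (1 / (n : ℝ)) _), concaveKernelConst]
    linarith
  rw [intervalIntegral.integral_of_le (by linarith)] at hI
  have hint : IntegrableOn (fun t => (K t : ℂ)) (Ioc (-Real.pi) Real.pi) :=
    (Complex.continuous_ofReal.comp (continuous_evenKernel a n)).integrableOn_Icc.mono_set
      Ioc_subset_Icc_self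
  rw [← ofReal_integral_norm_eq_lintegral_enorm hint]
  refine ENNReal.ofReal_le_ofReal ?_
  simpa only [Complex.norm_real, Real.norm_eq_abs] using hI

theorem rieszWeight_antitone {γ : ℝ} (hγ : 0 < γ) (n : ℕ) : Antitone (rieszWeight γ n) :=
  fun i j hij => by
    refine Real.rpow_le_rpow (le_max_right _ _) (max_le_max ?_ le_rfl) hγ.le
    gcongr

theorem concaveWeights_rieszWeight {γ : ℝ} (hγ : 0 < γ) (hγ1 : γ ≤ 1) {n : ℕ} (hn : 1 ≤ n) :
    ConcaveWeights (rieszWeight γ n) n where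
  zero_le_one := (rieszWeight_zero γ n).le
  vanish k hk := rieszWeight_of_ge hγ hn hk
  anti k := rieszWeight_antitone hγ n (Nat.le_succ k)
  concave k hk := by
    have hn0 : (0 : ℝ) < n := by exact_mod_cast hn
    have hk2 : (k : ℝ) + 2 ≤ n := by exact_mod_cast hk
    rw [rieszWeight_of_le hn (by omega), rieszWeight_of_le hn (by omega),
      rieszWeight_of_le hn (by omega)]
    have h := (Real.concaveOn_rpow hγ.le hγ1).slope_anti_adjacent
      (x := 1 - ((k + 2 : ℕ) : ℝ) / n) (y := 1 - ((k + 1 : ℕ) : ℝ) / n) (z := 1 - (k : ℝ) / n)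
      ?_ ?_ ?_ ?_
    · have e1 : 1 - (k : ℝ) / n - (1 - ((k + 1 : ℕ) : ℝ) / n) = 1 / n := by push_cast; ring
      have e2 : 1 - ((k + 1 : ℕ) : ℝ) / n - (1 - ((k + 2 : ℕ) : ℝ) / n) = 1 / n := by
        push_cast; ring
      rw [e1, e2] at h
      exact (div_le_div_iff_of_pos_right (by positivity)).1 h
    · rw [mem_Ici, sub_nonneg, div_le_one hn0]; push_cast; linarith
    · rw [mem_Ici, sub_nonneg, div_le_one hn0]; linarith
    · gcongr; omega
    · gcongr; omega

/-- The weights that agree with `a` on `{0, …, m}` and decrease linearly to `0` on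
`{m, …, n}`. -/
noncomputable def chordWeights (a : ℕ → ℝ) (m n k : ℕ) : ℝ :=
  if k ≤ m then a k else a m * (((n - k : ℕ) : ℝ) / ((n - m : ℕ) : ℝ))

theorem chordWeights_of_le {a : ℕ → ℝ} {m n k : ℕ} (h : k ≤ m) : chordWeights a m n k = a k :=
  if_pos h

theorem chordWeights_of_ge {a : ℕ → ℝ} {m n k : ℕ} (hmn : m < n) (h : m ≤ k) :
    chordWeights a m n k = a m * (((n - k : ℕ) : ℝ) / ((n - m : ℕ) : ℝ)) := by
  rcases h.eq_or_lt with rfl | h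
  · have : ((n - m : ℕ) : ℝ) ≠ 0 := by exact_mod_cast (by omega : n - m ≠ 0)
    rw [chordWeights_of_le le_rfl, div_self this, mul_one]
  · exact if_neg (by omega)

theorem ConcaveWeights.chordWeights {a : ℕ → ℝ} {n m : ℕ} (h : ConcaveWeights a n) (hmn : m < n) :
    ConcaveWeights (chordWeights a m n) n where
  zero_le_one := by rw [chordWeights_of_le (Nat.zero_le m)]; exact h.zero_le_one
  vanish k hk := by
    rw [chordWeights_of_ge hmn (by omega), Nat.sub_eq_zero_of_le hk]; simp
  anti k := by
    rcases Nat.lt_or_ge k m with hk | hk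
    · rw [chordWeights_of_le hk, chordWeights_of_le hk.le]; exact h.anti k
    · rw [chordWeights_of_ge hmn hk, chordWeights_of_ge hmn (by omega)]
      have := h.nonneg m
      have : ((n - (k + 1) : ℕ) : ℝ) ≤ ((n - k : ℕ) : ℝ) := by exact_mod_cast (by omega)
      gcongr
  concave k hk := by
    have hpos : (0 : ℝ) < ((n - m : ℕ) : ℝ) := by exact_mod_cast (by omega : 0 < n - m)
    rcases Nat.lt_or_ge k m with hkm | hkm
    · rcases Nat.lt_or_ge (k + 1) m with hkm' | hkm'
      · rw [chordWeights_of_le hkm.le, chordWeights_of_le hkm, chordWeights_of_le hkm']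
        exact h.concave k hk
      · obtain rfl : m = k + 1 := by omega
        rw [chordWeights_of_le hkm.le, chordWeights_of_le le_rfl,
          chordWeights_of_ge hmn (Nat.le_succ _)]
        have h1 := h.mul_decr_le (m := k) (l := n - (k + 1)) (by omega)
        rw [h.vanish (k + 1 + (n - (k + 1))) (by omega), sub_zero] at h1
        have e : ((n - (k + 2) : ℕ) : ℝ) = ((n - (k + 1) : ℕ) : ℝ) - 1 := by
          rw [← Nat.sub_sub n (k + 1) 1, Nat.cast_sub (by omega)]; simp
        rw [e, sub_div, div_self hpos.ne']
        have : a k - a (k + 1) ≤ a (k + 1) / ((n - (k + 1) : ℕ) : ℝ) := by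
          rw [le_div_iff₀ hpos]; linarith
        linear_combination this
    · rw [chordWeights_of_ge hmn hkm, chordWeights_of_ge hmn (by omega),
        chordWeights_of_ge hmn (by omega)]
      have e1 : ((n - k : ℕ) : ℝ) = ((n - (k + 2) : ℕ) : ℝ) + 2 := by
        exact_mod_cast (by omega : n - k = n - (k + 2) + 2)
      have e2 : ((n - (k + 1) : ℕ) : ℝ) = ((n - (k + 2) : ℕ) : ℝ) + 1 := by
        exact_mod_cast (by omega : n - (k + 1) = n - (k + 2) + 1)
      rw [e1, e2]
      apply le_of_eq; ring

/-! ### The rate of the Riesz means -/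

theorem PeriodicIntegrable.meas_shift {G : ℝ → ℂ} (hG : PeriodicIntegrable G) :
    AEStronglyMeasurable (Function.uncurry fun x t : ℝ => G (x + t)) (volume.prod volume) :=
  hG.meas.comp_quasiMeasurePreserving (quasiMeasurePreserving_add volume volume)

/-- Young's inequality `‖K * G‖_p ≤ ‖K‖_1 ‖G‖_p`. -/
theorem perNorm_perConv_le {p : ℝ≥0∞} (hp : 1 ≤ p) {G : ℝ → ℂ} (hG : PeriodicIntegrable G)
    {K : ℝ → ℂ} (hK : Continuous K) :
    perNorm p (perConv K G) ≤ (∫⁻ t in Ioc (-Real.pi) Real.pi, ‖K t‖ₑ) * perNorm p G := by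
  unfold perConv
  rw [perNorm_const_mul]
  refine (mul_le_mul' enorm_one_div_two_pi_le (perNorm_setIntegral_mul_le hp hK hG.meas_shift
    measurableSet_Ioc (M := perNorm p G) fun t _ => (perNorm_translate p hG t).le)).trans ?_
  rw [one_mul]

theorem perConv_sub {G H : ℝ → ℂ} (hG : PeriodicIntegrable G) (hH : PeriodicIntegrable H)
    {K : ℝ → ℂ} (hK : Continuous K) (x : ℝ) :
    perConv K (fun x => G x - H x) x = perConv K G x - perConv K H x := by
  simp only [perConv, mul_sub]
  rw [integral_sub (hG.integrableOn_mul hK x _ _) (hH.integrableOn_mul hK x _ _)]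
  ring

/-- The constant in the rate of the Riesz means: the first entry serves `γ ≥ 1`, the second
`γ ≤ 1`. -/
noncomputable def rieszConst (γ : ℝ) : ℝ :=
  max (γ * fejerConst) (4 * fejerConst + (concaveKernelConst γ 1 + concaveKernelConst γ 2)
    * (4 * fejerConst))

theorem rieszConst_pos {γ : ℝ} (hγ : 0 < γ) : 0 < rieszConst γ :=
  lt_max_of_lt_left (mul_pos hγ fejerConst_pos)

/-- For `γ ≥ 1` the weights are convex, and the sum of their second differences telescopes to the
first decrement, which Bernoulli's inequality estimates. -/
theorem sum_abs_secondDiff_rieszWeight_le {γ : ℝ} (hγ : 1 ≤ γ) {n : ℕ} (hn : 1 ≤ n) :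
    ∑ j ∈ Finset.range n, |secondDiff (rieszWeight γ n) j| ≤ γ / n := by
  have hγ0 : 0 < γ := by linarith
  have hn0 : (0 : ℝ) < n := by exact_mod_cast hn
  have hn1 : 1 / (n : ℝ) ≤ 1 := by
    rw [div_le_one hn0]; exact_mod_cast hn
  have hpos : ∀ j ∈ Finset.range n, 0 ≤ secondDiff (rieszWeight γ n) j := by
    intro k hk
    have hk := Finset.mem_range.1 hk
    rcases Nat.lt_or_ge (k + 1) n with hkn | hkn
    · have hk2 : (k : ℝ) + 2 ≤ n := by exact_mod_cast hkn
      rw [secondDiff, sub_nonneg, rieszWeight_of_le hn (by omega), rieszWeight_of_le hn (by omega),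
        rieszWeight_of_le hn (by omega)]
      have h := (convexOn_rpow hγ).slope_mono_adjacent
        (x := 1 - ((k + 2 : ℕ) : ℝ) / n) (y := 1 - ((k + 1 : ℕ) : ℝ) / n) (z := 1 - (k : ℝ) / n)
        ?_ ?_ ?_ ?_
      · have e1 : 1 - (k : ℝ) / n - (1 - ((k + 1 : ℕ) : ℝ) / n) = 1 / n := by push_cast; ring
        have e2 : 1 - ((k + 1 : ℕ) : ℝ) / n - (1 - ((k + 2 : ℕ) : ℝ) / n) = 1 / n := by
          push_cast; ring
        rw [e1, e2] at h
        exact (div_le_div_iff_of_pos_right (by positivity)).1 h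
      · rw [mem_Ici, sub_nonneg, div_le_one hn0]; push_cast; linarith
      · rw [mem_Ici, sub_nonneg, div_le_one hn0]; linarith
      · gcongr; omega
      · gcongr; omega
    · rw [secondDiff, rieszWeight_of_ge hγ0 hn hkn,
        rieszWeight_of_ge (k := k + 2) hγ0 hn (by omega)]
      have : 0 ≤ rieszWeight γ n k := Real.rpow_nonneg (le_max_right _ _) _
      linarith
  have habs : ∑ j ∈ Finset.range n, |secondDiff (rieszWeight γ n) j|
      = ∑ j ∈ Finset.range n, ((rieszWeight γ n j - rieszWeight γ n (j + 1))
        - (rieszWeight γ n (j + 1) - rieszWeight γ n (j + 1 + 1))) :=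
    Finset.sum_congr rfl fun j hj => abs_of_nonneg (hpos j hj)
  rw [habs, Finset.sum_range_sub' (fun j => rieszWeight γ n j - rieszWeight γ n (j + 1)),
    rieszWeight_zero, rieszWeight_of_ge hγ0 hn le_rfl, rieszWeight_of_ge hγ0 hn (Nat.le_succ n),
    rieszWeight_of_le hn (by omega)]
  have hb := one_add_mul_self_le_rpow_one_add (s := -(1 / (n : ℝ))) (by linarith) hγ
  have e : 1 - ((0 + 1 : ℕ) : ℝ) / n = 1 + -(1 / (n : ℝ)) := by push_cast; ring
  rw [e]
  linear_combination hb

/-- For `γ < 1` the weights are replaced by their chord beyond `n / 2`. The modified weights are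
handled by summation by parts; the kernel of the remainder is bounded in `L¹` and annihilates the
polynomials of degree at most `n / 2`, such as a Fejér mean of `G`. -/
theorem perNorm_convDiff_rieszWeight_le_of_le_one {p : ℝ≥0∞} (hp : 1 ≤ p) {G : ℝ → ℂ}
    (hG : PeriodicIntegrable G) {γ : ℝ} (hγ : 0 < γ) (hγ1 : γ ≤ 1) {n : ℕ} (hn : 1 ≤ n) :
    perNorm p (convDiff (evenKernel (rieszWeight γ n) n) G)
      ≤ ENNReal.ofReal (rieszConst γ / n) * modulusSum p G n := by
  have hn0 : (0 : ℝ) < n := by exact_mod_cast hn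
  have hF := fejerConst_pos
  set a := rieszWeight γ n with ha_def
  set m := n / 2 with hm
  have hmn : m < n := by omega
  have hm2 : (n : ℝ) ≤ 2 * (n - m : ℕ) := by exact_mod_cast (by omega)
  have hm1 : (n : ℝ) ≤ 2 * (m + 1 : ℕ) := by exact_mod_cast (by omega)
  have hd : (0 : ℝ) < ((n - m : ℕ) : ℝ) := by exact_mod_cast (by omega : 0 < n - m)
  have hca : ConcaveWeights a n := concaveWeights_rieszWeight hγ hγ1 hn
  have hcμ := hca.chordWeights hmn
  set μ := chordWeights a m n with hμ
  set b := rieszWeight 1 (m + 1) with hb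
  have hcb : ConcaveWeights b (m + 1) := concaveWeights_rieszWeight one_pos le_rfl (by omega)
  have ham : a m ≤ 1 := (hca.antitone (Nat.zero_le m)).trans hca.zero_le_one
  have ham0 := hca.nonneg m
  -- the chord weights
  have hmain : perNorm p (convDiff (evenKernel μ n) G)
      ≤ ENNReal.ofReal (4 / n * fejerConst) * modulusSum p G n := by
    refine perNorm_convDiff_evenKernel_le hp hG (hcμ.vanish n le_rfl) (hcμ.vanish _ (Nat.le_succ n))
      ((hcμ.sum_abs_secondDiff_le hn).trans ?_)
    rw [hμ, chordWeights_of_ge hmn (by omega), show n - (n - 1) = 1 by omega, Nat.cast_one]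
    calc 2 * (a m * (1 / ((n - m : ℕ) : ℝ))) ≤ 2 * (1 * (1 / ((n - m : ℕ) : ℝ))) := by gcongr
      _ = 4 / (2 * ((n - m : ℕ) : ℝ)) := by field_simp; norm_num
      _ ≤ 4 / n := by gcongr
  -- the Fejér mean of order `m + 1`
  have hfej : perNorm p (convDiff (evenKernel b (m + 1)) G)
      ≤ ENNReal.ofReal (4 / n * fejerConst) * modulusSum p G n := by
    refine (perNorm_convDiff_evenKernel_le hp hG (hcb.vanish _ le_rfl)
      (hcb.vanish _ (Nat.le_succ _)) (B := 4 / n)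
      ((hcb.sum_abs_secondDiff_le (by omega)).trans ?_)).trans ?_
    · rw [Nat.add_sub_cancel, hb, rieszWeight_of_le (by omega) (Nat.le_succ m), Real.rpow_one]
      have e : 2 * (1 - (m : ℝ) / ((m + 1 : ℕ) : ℝ)) = 4 / (2 * ((m + 1 : ℕ) : ℝ)) := by
        push_cast; field_simp; ring
      rw [e]
      gcongr
    · gcongr
      exact modulusSum_mono (by omega)
  -- the remainder
  set ν : ℕ → ℝ := fun k => a k - μ k with hν
  have hν0 : ∀ k ≤ m, ν k = 0 := fun k hk => by
    simp only [hν, hμ, chordWeights_of_le hk, sub_self]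
  have hνb : ∀ k, ν k * b k = 0 := fun k => by
    rcases le_or_gt k m with hk | hk
    · rw [hν0 k hk, zero_mul]
    · rw [hcb.vanish k hk, mul_zero]
  have hμa : ∀ k ≤ n, μ k ≤ 2 * rieszWeight γ n k := by
    intro k hk
    have hk0 := hca.nonneg k
    rcases le_or_gt k m with hkm | hkm
    · rw [hμ, chordWeights_of_le hkm, ← ha_def]; linarith
    · rw [hμ, chordWeights_of_ge hmn hkm.le, rieszWeight_of_le hn hk]
      have hx : 1 - (k : ℝ) / n = ((n - k : ℕ) : ℝ) / n := by
        rw [Nat.cast_sub hk]; field_simp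
      have hx1 : ((n - k : ℕ) : ℝ) / n ≤ 1 := by
        rw [div_le_one hn0]; exact_mod_cast Nat.sub_le n k
      have hx2 : ((n - k : ℕ) : ℝ) / n ≤ (((n - k : ℕ) : ℝ) / n) ^ γ := by
        rcases (by positivity : 0 ≤ ((n - k : ℕ) : ℝ) / n).eq_or_lt with h0 | h0
        · rw [← h0, Real.zero_rpow hγ.ne']
        · simpa using Real.rpow_le_rpow_of_exponent_ge h0 hx1 hγ1
      rw [hx]
      calc a m * (((n - k : ℕ) : ℝ) / ((n - m : ℕ) : ℝ))
          ≤ 1 * (((n - k : ℕ) : ℝ) / (n / 2)) := by gcongr; linarith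
        _ = 2 * (((n - k : ℕ) : ℝ) / n) := by field_simp
        _ ≤ _ := by linarith
  have hL1 : ∫⁻ t in Ioc (-Real.pi) Real.pi, ‖(evenKernel ν n t : ℂ)‖ₑ
      ≤ ENNReal.ofReal (concaveKernelConst γ 1 + concaveKernelConst γ 2) := by
    have h1 := hca.lintegral_evenKernel_le hn hγ zero_le_one fun k _ => (one_mul (a k)).ge
    have h2 := hcμ.lintegral_evenKernel_le hn hγ zero_le_two hμa
    have hmeas : Measurable fun t => ‖(evenKernel a n t : ℂ)‖ₑ :=
      (Complex.continuous_ofReal.comp (continuous_evenKernel a n)).measurable.enorm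
    calc _ ≤ ∫⁻ t in Ioc (-Real.pi) Real.pi,
          (‖(evenKernel a n t : ℂ)‖ₑ + ‖(evenKernel μ n t : ℂ)‖ₑ) := by
          refine lintegral_mono fun t => ?_
          rw [hν, evenKernel_sub, Complex.ofReal_sub]
          exact enorm_sub_le
      _ ≤ _ := by
          rw [lintegral_add_left hmeas, ENNReal.ofReal_add]
          · exact add_le_add h1 h2
          · unfold concaveKernelConst; positivity
          · unfold concaveKernelConst; positivity
  have hKν : Continuous fun t => (evenKernel ν n t : ℂ) :=
    Complex.continuous_ofReal.comp (continuous_evenKernel ν n)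
  have hrem : perNorm p (convDiff (evenKernel ν n) G)
      ≤ ENNReal.ofReal ((concaveKernelConst γ 1 + concaveKernelConst γ 2) * (4 / n * fejerConst))
        * modulusSum p G n := by
    set P := perConv (fun t => (evenKernel b (m + 1) t : ℂ)) G with hP
    have hPp : PeriodicIntegrable P := perConv_evenKernel_periodicIntegrable hG _ _
    have e1 : convDiff (evenKernel ν n) G
        = perConv (fun t => (evenKernel ν n t : ℂ)) (fun x => G x - P x) := by
      funext x
      rw [perConv_sub hG hPp hKν, hP, perConv_perConv_eq_zero hG hνb, convDiff_evenKernel hG,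
        hν0 0 (Nat.zero_le m)]
      simp
    have e2 : perNorm p (fun x => G x - P x) = perNorm p (convDiff (evenKernel b (m + 1)) G) := by
      refine perNorm_congr_norm p fun x => ?_
      rw [convDiff_evenKernel hG, hb, rieszWeight_zero, Complex.ofReal_one, one_mul, norm_sub_rev]
    rw [e1]
    refine (perNorm_perConv_le hp (hG.sub hPp) hKν).trans ?_
    rw [e2]
    refine (mul_le_mul' hL1 hfej).trans_eq ?_
    rw [← mul_assoc, ← ENNReal.ofReal_mul]
    unfold concaveKernelConst; positivity
  have hsplit : convDiff (evenKernel a n) G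
      = fun x => convDiff (evenKernel μ n) G x + convDiff (evenKernel ν n) G x := by
    funext x
    have : evenKernel ν n = fun t => evenKernel a n t - evenKernel μ n t := by
      funext t; exact evenKernel_sub a μ n t
    rw [this, convDiff_sub hG (continuous_evenKernel a n) (continuous_evenKernel μ n)]
    ring
  rw [hsplit]
  refine (perNorm_add_le hp (meas_convDiff hG (continuous_evenKernel μ n))
    (meas_convDiff hG (continuous_evenKernel ν n))).trans ((add_le_add hmain hrem).trans ?_)
  have hc0 : 0 ≤ concaveKernelConst γ 1 + concaveKernelConst γ 2 := by
    unfold concaveKernelConst; positivity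
  rw [← add_mul, ← ENNReal.ofReal_add (by positivity) (by positivity)]
  gcongr
  calc _ = (4 * fejerConst + (concaveKernelConst γ 1 + concaveKernelConst γ 2)
      * (4 * fejerConst)) / n := by ring
    _ ≤ _ := by gcongr; exact le_max_right _ _

/-- The error of the Riesz means is at most a constant times `(1/n) ∑_{k = 1}^n ω_p(G, 1/k)`, the
same rate as for the Fejér means. -/
theorem perNorm_convDiff_rieszWeight_le {p : ℝ≥0∞} (hp : 1 ≤ p) {G : ℝ → ℂ}
    (hG : PeriodicIntegrable G) {γ : ℝ} (hγ : 0 < γ) {n : ℕ} (hn : 1 ≤ n) :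
    perNorm p (convDiff (evenKernel (rieszWeight γ n) n) G)
      ≤ ENNReal.ofReal (rieszConst γ / n) * modulusSum p G n := by
  rcases le_total γ 1 with h | h
  · exact perNorm_convDiff_rieszWeight_le_of_le_one hp hG hγ h hn
  · refine (perNorm_convDiff_evenKernel_le hp hG (rieszWeight_of_ge hγ hn le_rfl)
      (rieszWeight_of_ge hγ hn (Nat.le_succ n)) (sum_abs_secondDiff_rieszWeight_le h hn)).trans ?_
    gcongr
    rw [div_mul_eq_mul_div]
    gcongr
    exact le_max_left _ _

/-! ### Generalized Hölder classes -/

theorem periodicIntegrable_of_mem_PerLp {p : ℝ≥0∞} (hp : 1 ≤ p) {f : ℝ → ℝ} (hf : f ∈ PerLp p) :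
    PeriodicIntegrable fun x => (f x : ℂ) := by
  obtain ⟨hper, h⟩ := hf
  have hperC : Function.Periodic (fun x => (f x : ℂ)) (2 * Real.pi) := fun x => by
    simp only [hper x]
  split_ifs at h with hpt
  · exact .of_continuous hperC (Complex.continuous_ofReal.comp h.1.continuous)
  · have h1 : IntegrableOn (fun x => (f x : ℂ)) (Ioc 0 (2 * Real.pi)) := (h.integrable hp).ofReal
    have h2 : ∀ a b, IntervalIntegrable (fun x => (f x : ℂ)) volume a b :=
      hperC.intervalIntegrable₀ Real.two_pi_pos.ne'
        ((intervalIntegrable_iff_integrableOn_Ioc_of_le Real.two_pi_pos.le).2 h1)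
    refine ⟨hperC, ?_, h2⟩
    have hU : (⋃ n : ℕ, Ioc (-(n : ℝ)) n) = univ := by
      refine eq_univ_of_forall fun x => ?_
      obtain ⟨n, hn⟩ := exists_nat_gt |x|
      exact mem_iUnion.2 ⟨n, (abs_lt.1 hn).1, (abs_lt.1 hn).2.le⟩
    rw [← Measure.restrict_univ (μ := volume), ← hU, aestronglyMeasurable_iUnion_iff]
    exact fun n => (h2 (-n) n).1.aestronglyMeasurable

theorem perNorm_fwdDiff_le_holderSeminorm_mul {w : ℝ≥0 → ℝ≥0} {p : ℝ≥0∞} {f : ℝ → ℝ}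
    (hf : holderSeminorm w p f ≠ ∞) (h : ℝ) :
    perNorm p (fwdDiff h fun x => (f x : ℂ)) ≤ holderSeminorm w p f * w ‖h‖₊ := by
  rcases eq_or_ne h 0 with rfl | h0
  · have e : (fwdDiff 0 fun x => (f x : ℂ)) = fun _ => 0 := by funext x; simp [fwdDiff]
    rw [e, perNorm_zero]; exact zero_le
  · have e : perNorm p (fwdDiff h fun x => (f x : ℂ)) = perNorm p (fwdDiff h f) :=
      perNorm_congr_norm p fun x => by
        simp only [fwdDiff]; rw [← Complex.ofReal_sub, Complex.norm_real]
    have h1 : perNorm p (fwdDiff h f) / (w ‖h‖₊ : ℝ≥0∞) ≤ holderSeminorm w p f :=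
      le_iSup₂ (f := fun (h : ℝ) (_ : h ≠ 0) => perNorm p (fwdDiff h f) / (w ‖h‖₊ : ℝ≥0∞)) h h0
    rw [e]
    exact (ENNReal.div_le_iff_le_mul (Or.inr hf) (Or.inl ENNReal.coe_ne_top)).1 h1

theorem perNorm_convDiff_rieszWeight_le_mul {p : ℝ≥0∞} (hp : 1 ≤ p) {G : ℝ → ℂ}
    (hG : PeriodicIntegrable G) {γ : ℝ} (hγ : 0 < γ) {n : ℕ} (hn : 1 ≤ n) {B : ℝ≥0∞} {u : ℕ → ℝ≥0}
    (hu : ∀ k : ℕ, modulus p G (1 / (k + 1)) ≤ B * u (k + 1)) :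
    perNorm p (convDiff (evenKernel (rieszWeight γ n) n) G)
      ≤ ENNReal.ofReal (rieszConst γ) * B
        * (((1 / (n : ℝ≥0)) * ∑ k ∈ Finset.Icc 1 n, u k : ℝ≥0) : ℝ≥0∞) := by
  have hn0 : (0 : ℝ) < n := by exact_mod_cast hn
  have hsum : ∑ k ∈ Finset.range n, u (k + 1) = ∑ k ∈ Finset.Icc 1 n, u k := by
    rw [Finset.range_eq_Ico, Finset.sum_Ico_add' u 0 n 1]
    congr 1
  have h1 : modulusSum p G n ≤ B * ((∑ k ∈ Finset.Icc 1 n, u k : ℝ≥0) : ℝ≥0∞) := by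
    rw [← hsum, modulusSum]
    push_cast
    rw [Finset.mul_sum]
    exact Finset.sum_le_sum fun k _ => hu k
  have h2 : ENNReal.ofReal (rieszConst γ / n)
      = ENNReal.ofReal (rieszConst γ) * ((1 / (n : ℝ≥0) : ℝ≥0) : ℝ≥0∞) := by
    rw [div_eq_mul_one_div, ENNReal.ofReal_mul (rieszConst_pos hγ).le]
    congr 1
    rw [← ENNReal.ofReal_coe_nnreal]
    simp
  refine (perNorm_convDiff_rieszWeight_le hp hG hγ hn).trans ((mul_le_mul_right h1 _).trans_eq ?_)
  rw [h2]
  push_cast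
  ring

theorem NNReal.min_le_rpow_mul_rpow (x y : ℝ≥0) {θ : ℝ} (h0 : 0 ≤ θ) (h1 : θ ≤ 1) :
    min x y ≤ x ^ θ * y ^ (1 - θ) := by
  have e : min x y = (min x y) ^ θ * (min x y) ^ (1 - θ) := by
    rw [← NNReal.rpow_add' (by simp), add_sub_cancel, NNReal.rpow_one]
  rw [e]
  gcongr
  · exact min_le_left _ _
  · exact min_le_right _ _

theorem nnnorm_le_one_div_of_abs_le {t : ℝ} {k : ℕ} (h : |t| ≤ 1 / (k + 1)) :
    ‖t‖₊ ≤ 1 / ((k + 1 : ℕ) : ℝ≥0) := by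
  rw [← NNReal.coe_le_coe]
  push_cast
  exact h

/-- The differences `Δ_h f` satisfy the estimate for `f` with modulus `ω^{1-θ}` and constant
`ω(|h|)^θ`, because `Δ_t Δ_h f` is controlled both by `ω(|t|)` and by `ω(|h|)`. -/
theorem holderNorm_rieszMean_sub_le {p : ℝ≥0∞} (hp : 1 ≤ p) {γ θ : ℝ} (hγ : 0 < γ) (hθ0 : 0 ≤ θ)
    (hθ1 : θ < 1) {ω ωs : ℝ≥0 → ℝ≥0} (hω : Monotone ω) {f : ℝ → ℝ} (hf : f ∈ PerHolder ω p) :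
    ∃ C : ℝ≥0, ∀ n : ℕ, 1 ≤ n →
      holderNorm ωs p (fun x => rieszMean γ n f x - (f x : ℂ)) ≤
        (C : ℝ≥0∞)
          * (⨆ (h : ℝ) (_ : h ≠ 0), ((ω ‖h‖₊ ^ θ : ℝ≥0) : ℝ≥0∞) / (ωs ‖h‖₊ : ℝ≥0∞))
          * (((1 / (n : ℝ≥0)) *
              ∑ k ∈ Finset.Icc 1 n, ω (1 / (k : ℝ≥0)) ^ (1 - θ) : ℝ≥0) : ℝ≥0∞) := by
  obtain ⟨hfL, hfA⟩ := hf
  have hF := periodicIntegrable_of_mem_PerLp hp hfL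
  set F : ℝ → ℂ := fun x => (f x : ℂ) with hFdef
  set A := (holderSeminorm ω p f).toNNReal with hA
  have hAF : ∀ h, perNorm p (fwdDiff h F) ≤ A * ω ‖h‖₊ := fun h => by
    rw [hA, ENNReal.coe_toNNReal hfA.ne]
    exact perNorm_fwdDiff_le_holderSeminorm_mul hfA.ne h
  set Q : ℝ≥0∞ := ⨆ (h : ℝ) (_ : h ≠ 0), ((ω ‖h‖₊ ^ θ : ℝ≥0) : ℝ≥0∞) / (ωs ‖h‖₊ : ℝ≥0∞) with hQ
  have hQh : ∀ h : ℝ, h ≠ 0 → ((ω ‖h‖₊ ^ θ : ℝ≥0) : ℝ≥0∞) / (ωs ‖h‖₊ : ℝ≥0∞) ≤ Q := fun h h0 =>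
    le_iSup₂ (f := fun (h : ℝ) (_ : h ≠ 0) =>
      ((ω ‖h‖₊ ^ θ : ℝ≥0) : ℝ≥0∞) / (ωs ‖h‖₊ : ℝ≥0∞)) h h0
  set c : ℝ≥0 := (rieszConst γ).toNNReal with hc
  -- the denominator is enlarged, as `ωs 1` may vanish while `Q = ∞`
  have hQ1 : ((ω 1 ^ θ : ℝ≥0) : ℝ≥0∞) ≤ Q * ((1 + ωs 1 : ℝ≥0) : ℝ≥0∞) := by
    refine (ENNReal.div_le_iff_le_mul (Or.inl ?_) (Or.inl ENNReal.coe_ne_top)).1 ?_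
    · exact_mod_cast (add_pos_of_pos_of_nonneg one_pos zero_le).ne'
    · have h1 := hQh 1 one_ne_zero
      rw [nnnorm_one] at h1
      refine (ENNReal.div_le_div_left ?_ _).trans h1
      exact_mod_cast le_add_of_nonneg_left zero_le
  refine ⟨c * (A * (1 + ωs 1)) + c * (2 * A), fun n hn => ?_⟩
  set S : ℝ≥0 := (1 / (n : ℝ≥0)) * ∑ k ∈ Finset.Icc 1 n, ω (1 / (k : ℝ≥0)) ^ (1 - θ) with hS
  rw [holderNorm, rieszMean_sub_eq hn hF]
  have hfirst : perNorm p (convDiff (evenKernel (rieszWeight γ n) n) F)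
      ≤ ((c * (A * (1 + ωs 1)) : ℝ≥0) : ℝ≥0∞) * Q * S := by
    refine (perNorm_convDiff_rieszWeight_le_mul hp hF hγ hn (B := ((A * ω 1 ^ θ : ℝ≥0) : ℝ≥0∞))
      (u := fun k => ω (1 / (k : ℝ≥0)) ^ (1 - θ)) fun k => ?_).trans ?_
    · refine iSup₂_le fun t ht => (hAF t).trans ?_
      have h1 : ω ‖t‖₊ ≤ ω (1 / ((k + 1 : ℕ) : ℝ≥0)) := hω (nnnorm_le_one_div_of_abs_le ht)
      have h2 : ω (1 / ((k + 1 : ℕ) : ℝ≥0)) ≤ ω 1 := hω (by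
        rw [div_le_one (by positivity)]; push_cast; exact le_add_of_nonneg_left zero_le)
      have h3 := NNReal.min_le_rpow_mul_rpow (ω 1) (ω (1 / ((k + 1 : ℕ) : ℝ≥0))) hθ0 hθ1.le
      rw [min_eq_right h2] at h3
      norm_cast
      rw [mul_assoc]
      exact mul_le_mul_right (h1.trans (by exact_mod_cast h3)) A
    · have e : ((c * (A * (1 + ωs 1)) : ℝ≥0) : ℝ≥0∞) * Q
          = c * (A * (Q * ((1 + ωs 1 : ℝ≥0) : ℝ≥0∞))) := by push_cast; ring
      rw [e, ENNReal.coe_mul]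
      gcongr
      exact le_rfl
  have hsecond : holderSeminorm ωs p (convDiff (evenKernel (rieszWeight γ n) n) F)
      ≤ ((c * (2 * A) : ℝ≥0) : ℝ≥0∞) * Q * S := by
    refine iSup₂_le fun h h0 => ?_
    rw [fwdDiff_convDiff hF (continuous_evenKernel _ _)]
    have hb := perNorm_convDiff_rieszWeight_le_mul hp (hF.fwdDiff h) hγ hn
      (B := ((2 * A * ω ‖h‖₊ ^ θ : ℝ≥0) : ℝ≥0∞))
      (u := fun k => ω (1 / (k : ℝ≥0)) ^ (1 - θ)) fun k => ?_
    · calc _ ≤ (c * ((2 * A * ω ‖h‖₊ ^ θ : ℝ≥0) : ℝ≥0∞) * S) / (ωs ‖h‖₊ : ℝ≥0∞) :=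
            ENNReal.div_le_div_right hb _
        _ = ((c * (2 * A) : ℝ≥0) : ℝ≥0∞)
            * (((ω ‖h‖₊ ^ θ : ℝ≥0) : ℝ≥0∞) / (ωs ‖h‖₊ : ℝ≥0∞)) * S := by
            simp only [ENNReal.coe_mul, div_eq_mul_inv]; ring
        _ ≤ _ := by gcongr; exact hQh h h0
    · refine iSup₂_le fun t ht => ?_
      have h1 : ω ‖t‖₊ ≤ ω (1 / ((k + 1 : ℕ) : ℝ≥0)) := hω (nnnorm_le_one_div_of_abs_le ht)
      have hFh := hF.fwdDiff h
      have hFt := hF.fwdDiff t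
      have ht1 : perNorm p (fwdDiff t (fwdDiff h F)) ≤ ((2 * A * ω ‖h‖₊ : ℝ≥0) : ℝ≥0∞) := by
        have := perNorm_sub_le hp (hFh.translate t).meas hFh.meas
        rw [perNorm_translate p hFh, ← two_mul] at this
        refine this.trans ((mul_le_mul_right (hAF h) 2).trans_eq ?_)
        push_cast; ring
      have ht2 : perNorm p (fwdDiff t (fwdDiff h F)) ≤ ((2 * A * ω ‖t‖₊ : ℝ≥0) : ℝ≥0∞) := by
        have e : fwdDiff t (fwdDiff h F) = fun x => fwdDiff t F (x + h) - fwdDiff t F x := by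
          funext x; simp only [fwdDiff]
          rw [show x + t + h = x + h + t by ring]; ring
        rw [e]
        have := perNorm_sub_le hp (hFt.translate h).meas hFt.meas
        rw [perNorm_translate p hFt, ← two_mul] at this
        refine this.trans ((mul_le_mul_right (hAF t) 2).trans_eq ?_)
        push_cast; ring
      have h3 := NNReal.min_le_rpow_mul_rpow (ω ‖h‖₊) (ω (1 / ((k + 1 : ℕ) : ℝ≥0))) hθ0 hθ1.le
      have h4 : min (2 * A * ω ‖h‖₊) (2 * A * ω ‖t‖₊)
          ≤ 2 * A * ω ‖h‖₊ ^ θ * ω (1 / ((k + 1 : ℕ) : ℝ≥0)) ^ (1 - θ) := by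
        rw [← mul_min, mul_assoc (2 * A)]
        exact mul_le_mul_right ((min_le_min le_rfl h1).trans h3) _
      refine (le_min ht1 ht2).trans ?_
      rw [← ENNReal.coe_min]
      exact_mod_cast h4
  rw [ENNReal.coe_add, add_mul, add_mul]
  exact add_le_add hfirst hsecond

/-! ### Power moduli -/

theorem sum_Icc_rpow_neg_le {δ : ℝ} (h0 : 0 ≤ δ) (h1 : δ < 1) (n : ℕ) :
    ∑ k ∈ Finset.Icc 1 n, (1 / (k : ℝ)) ^ δ ≤ (n : ℝ) ^ (1 - δ) / (1 - δ) := by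
  have hδ : 0 < 1 - δ := by linarith
  induction n with
  | zero => simp [Real.zero_rpow hδ.ne']
  | succ n ih =>
    rw [Finset.sum_Icc_succ_top (by omega)]
    have hn : (0 : ℝ) < n + 1 := by positivity
    have hn1 : 1 / ((n : ℝ) + 1) ≤ 1 := by
      rw [div_le_one hn]; linarith [Nat.cast_nonneg (α := ℝ) n]
    -- Bernoulli's inequality for `n / (n + 1)`
    have hb := rpow_one_add_le_one_add_mul_self (s := -(1 / ((n : ℝ) + 1))) (by linarith) hδ.le
      (by linarith)
    have e1 : 1 + -(1 / ((n : ℝ) + 1)) = n / (n + 1) := by field_simp; ring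
    rw [e1, Real.div_rpow (by positivity) hn.le, div_le_iff₀ (by positivity)] at hb
    have e2 : (1 / ((n : ℝ) + 1)) ^ δ = ((n : ℝ) + 1) ^ (1 - δ) / (n + 1) := by
      rw [one_div, Real.inv_rpow hn.le, Real.rpow_sub hn, Real.rpow_one]
      field_simp
    push_cast
    rw [e2]
    rw [le_div_iff₀ hδ] at ih ⊢
    calc (∑ k ∈ Finset.Icc 1 n, (1 / (k : ℝ)) ^ δ + ((n : ℝ) + 1) ^ (1 - δ) / (n + 1)) * (1 - δ)
        ≤ (1 + (1 - δ) * -(1 / ((n : ℝ) + 1))) * ((n : ℝ) + 1) ^ (1 - δ)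
          + ((n : ℝ) + 1) ^ (1 - δ) / (n + 1) * (1 - δ) := by
          rw [add_mul]; linarith
      _ = _ := by ring

/-- For power moduli the supremum of the quotients is at most `1` and the sum of moduli is a
partial sum of the series `∑ k^{-(α-β)}`. -/
theorem holderNorm_rieszMean_sub_le_of_rpow {p : ℝ≥0∞} (hp : 1 ≤ p) {γ β α : ℝ} (hγ : 0 < γ)
    (hβ : 0 ≤ β) (hβα : β < α) {f : ℝ → ℝ} (hf : f ∈ PerHolder (fun t => t ^ α) p) :
    ∃ C : ℝ, 0 ≤ C ∧ ∀ n : ℕ, 1 ≤ n →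
      holderNorm (fun t => t ^ β) p (fun x => rieszMean γ n f x - (f x : ℂ)) ≤
        ENNReal.ofReal (C * (1 / n * ∑ k ∈ Finset.Icc 1 n, (1 / (k : ℝ)) ^ (α - β))) := by
  have hα : 0 < α := by linarith
  obtain ⟨C, hC⟩ := holderNorm_rieszMean_sub_le (ωs := fun t => t ^ β) hp hγ (θ := β / α)
    (by positivity) (by rwa [div_lt_one hα]) (NNReal.monotone_rpow_of_nonneg hα.le) hf
  refine ⟨C, C.2, fun n hn => (hC n hn).trans ?_⟩
  have hQ : (⨆ (h : ℝ) (_ : h ≠ 0), (((‖h‖₊ ^ α) ^ (β / α) : ℝ≥0) : ℝ≥0∞)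
      / ((‖h‖₊ ^ β : ℝ≥0) : ℝ≥0∞)) ≤ 1 := by
    refine iSup₂_le fun h _ => ?_
    rw [← NNReal.rpow_mul, mul_div_cancel₀ _ hα.ne']
    exact ENNReal.div_self_le_one
  refine (mul_le_mul_left (mul_le_mul_right hQ (C : ℝ≥0∞)) _).trans_eq ?_
  rw [mul_one, ← ENNReal.coe_mul, ← ENNReal.ofReal_coe_nnreal]
  congr 1
  push_cast
  congr 2
  refine Finset.sum_congr rfl fun k _ => ?_
  rw [← Real.rpow_mul (by positivity)]
  congr 1
  field_simp

theorem sum_Icc_one_div_le {n : ℕ} (hn : 2 ≤ n) :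
    ∑ k ∈ Finset.Icc 1 n, (1 / (k : ℝ)) ≤ 3 * Real.log n := by
  have h := harmonic_le_one_add_log n
  rw [harmonic_eq_sum_Icc] at h
  push_cast at h
  have h2 : Real.log 2 ≤ Real.log n := Real.log_le_log two_pos (by exact_mod_cast hn)
  have := Real.log_two_gt_d9
  simp only [one_div]
  linarith

theorem mainTheorem8 (p : ℝ≥0∞) (hp : 1 ≤ p) :
    -- general moduli
    (∀ (γ β η : ℝ), 0 < γ → 0 ≤ β → β < η → η ≤ 1 →
      ∀ (ω ωs : ℝ≥0 → ℝ≥0), Monotone ω → Monotone ωs →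
      ∀ f ∈ PerHolder ω p, ∃ C : ℝ≥0, ∀ n : ℕ, 1 ≤ n →
        holderNorm ωs p (fun x => rieszMean γ n f x - (f x : ℂ)) ≤
          (C : ℝ≥0∞)
            * (⨆ (h : ℝ) (_ : h ≠ 0), ((ω ‖h‖₊ ^ (β / η) : ℝ≥0) : ℝ≥0∞) / (ωs ‖h‖₊ : ℝ≥0∞))
            * (((1 / (n : ℝ≥0)) *
                ∑ k ∈ Finset.Icc 1 n, ω (1 / (k : ℝ≥0)) ^ (1 - β / η) : ℝ≥0) : ℝ≥0∞)) ∧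
    -- power moduli
    (∀ (γ β α : ℝ), 0 < γ → 0 ≤ β → β < α → α ≤ 1 →
      ∀ f ∈ PerHolder (fun t => t ^ α) p,
        (α - β < 1 → ∃ C : ℝ, ∀ n : ℕ, 1 ≤ n →
          holderNorm (fun t => t ^ β) p (fun x => rieszMean γ n f x - (f x : ℂ)) ≤
            ENNReal.ofReal (C * (n : ℝ) ^ (β - α))) ∧
        (α - β = 1 → ∃ C : ℝ, ∀ n : ℕ, 2 ≤ n →
          holderNorm (fun t => t ^ β) p (fun x => rieszMean γ n f x - (f x : ℂ)) ≤
            ENNReal.ofReal (C * (Real.log n / n)))) ∧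
    -- the Fejér means are the case of exponent one
    (∀ (f : ℝ → ℝ) (n : ℕ), 1 ≤ n → rieszMean 1 n f = fejerMean n f) := by
  refine ⟨?_, ?_, fun f n hn => rieszMean_one_eq_fejerMean f hn⟩
  · intro γ β η hγ hβ hβη _ ω ωs hω _ f hf
    have hη : 0 < η := by linarith
    exact holderNorm_rieszMean_sub_le hp hγ (by positivity) (by rwa [div_lt_one hη]) hω hf
  · intro γ β α hγ hβ hβα _ f hf
    obtain ⟨C, hC0, hC⟩ := holderNorm_rieszMean_sub_le_of_rpow hp hγ hβ hβα hf
    refine ⟨fun hlt => ⟨C * (1 / (1 - (α - β))), fun n hn => (hC n hn).trans ?_⟩,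
      fun heq => ⟨C * 3, fun n hn => (hC n (by omega)).trans ?_⟩⟩
    · have hn0 : (0 : ℝ) < n := by exact_mod_cast hn
      refine ENNReal.ofReal_le_ofReal ?_
      calc C * (1 / n * ∑ k ∈ Finset.Icc 1 n, (1 / (k : ℝ)) ^ (α - β))
          ≤ C * (1 / n * ((n : ℝ) ^ (1 - (α - β)) / (1 - (α - β)))) := by
            gcongr; exact sum_Icc_rpow_neg_le (by linarith) hlt n
        _ = C * (1 / (1 - (α - β))) * (n : ℝ) ^ (β - α) := by
            rw [show 1 - (α - β) = β - α + 1 by ring, Real.rpow_add_one hn0.ne']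
            field_simp
    · refine ENNReal.ofReal_le_ofReal ?_
      rw [heq]
      simp only [Real.rpow_one]
      calc C * (1 / n * ∑ k ∈ Finset.Icc 1 n, (1 / (k : ℝ)))
          ≤ C * (1 / n * (3 * Real.log n)) := by gcongr; exact sum_Icc_one_div_le hn
        _ = C * 3 * (Real.log n / n) := by ring
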